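/- Let $s\ge 1$, let $-\infty<a_i<b_i<\infty$ for $i\in[s]=\{1,\dots,s\}$, and put $[\boldsymbol a,\boldsymbol b]=\prod_{i=1}^s[a_i,b_i]$. For each $i$ let $\varphi_i$ be a probability density on $[a_i,b_i]$ whose distribution function $\Phi_i(x)=\int_{a_i}^x\varphi_i(y)\,dy$ is an invertible map $[a_i,b_i]\to[0,1]$. Put $\varphi(\boldsymbol x)=\prod_i\varphi_i(x_i)$ and $\Phi^{-1}(\boldsymbol y)=(\Phi_1^{-1}(y_1),\dots,\Phi_s^{-1}(y_s))$. Let $\gamma_{\mathfrak u}>0$ for $\mathfrak u\subseteq[s]$, and let $1\le p,q\le\infty$ with $\frac1p+\frac1q=1$. For $F:[\boldsymbol a,\boldsymbol b]\to\mathbb R$ whose mixed partial derivatives $\frac{\partial^{|\mathfrak u|}F}{\partial\boldsymbol x_{\mathfrak u}}=\frac{\partial}{\partial x_{u_1}}\cdots\frac{\partial}{\partial x_{u_k}}F$, $\mathfrak u=\{u_1<\dots<u_k\}\subseteq[s]$, exist everywhere on $[\boldsymbol a,\boldsymbol b]$ (one-sided at the boundary), let $$\|F\|_{p,s,\boldsymbol\gamma}=\Bigl(\sum_{\mathfrak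 u\subseteq[s]}\Bigl(\frac1{\gamma_{\mathfrak u}}\sup_{\boldsymbol x\in[\boldsymbol a,\boldsymbol b]}\Bigl|\frac{\partial^{|\mathfrak u|}F}{\partial\boldsymbol x_{\mathfrak u}}(\boldsymbol x)\Bigr|\Bigr)^p\Bigr)^{1/p}$$ (the maximum over $\mathfrak u$ if $p=\infty$). For points $\mathcal P=\{\boldsymbol y_0,\dots,\boldsymbol y_{N-1}\}\subset[0,1]^s$ let $$\mathrm{wce}(\mathcal P;p,s,\boldsymbol\gamma,\varphi)=\sup_{\|F\|_{p,s,\boldsymbol\gamma}\le1}\Bigl|\frac1N\sum_{n=0}^{N-1}F(\Phi^{-1}(\boldsymbol y_n))-\int_{[\boldsymbol a,\boldsymbol b]}F(\boldsymbol x)\varphi(\boldsymbol x)\,d\boldsymbol x\Bigr|.$$ Let $C_1,\dots,C_s\in\mathbb F_2^{\mathbb N\times\mathbb N}$ be non-singular upper triangular matrices (zero below the diagonal, non-zero diagonal entries). For $n\in\mathbb N_0$ with binary digit vector $\vec n=(n_0,n_1,\dots)^\top$ let $C_i\vec n=(y_1^{(i)},y_2^{(i)},\dots)^\top$ over $\mathbb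 F_2$, and let $\boldsymbol x_n$ be the point with coordinates $x_n^{(i)}=\sum_{k\ge1}y_k^{(i)}2^{-k}$. Assume that $(\boldsymbol x_n)_{n\ge0}$ is a digital $((t_{\mathfrak u})_{\emptyset\ne\mathfrak u\subseteq[s]},s)$-sequence over $\mathbb F_2$, where $t_{\mathfrak u}\in\mathbb N_0$; that is, for every $\emptyset\ne\mathfrak u\subseteq[s]$, every $m\ge t_{\mathfrak u}$ and all integers $d_i\ge0$ $(i\in\mathfrak u)$ with $\sum_{i\in\mathfrak u}d_i=m-t_{\mathfrak u}$, the system consisting of the first $d_i$ rows of the upper left $m\times m$ submatrix of $C_i$, for all $i\in\mathfrak u$, is linearly independent over $\mathbb F_2$. Then for every integer $N\ge2$ the set $\mathcal P_N=\{\boldsymbol x_0,\dots,\boldsymbol x_{N-1}\}$ satisfies $$\mathrm{wce}(\mathcal P_N;p,s,\boldsymbol\gamma,\varphi)\le\frac1N\,\frac{3\log(2N)}{\log2}\Bigl(\sum_{\emptyset\ne\mathfrak u\subseteq[s]}\Bigl(\gamma_{\mathfrak u}\,2^{t_{\mathfrak u}}\,(3\log N)^{|\mathfrak u|}\prod_{i\in\mathfrak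 u}(b_i-a_i)\Bigr)^q\Bigr)^{1/q},$$ where $\log$ is the natural logarithm and, if $q=\infty$, the last factor is the maximum over $\emptyset\ne\mathfrak u\subseteq[s]$ of the terms in the inner parentheses. -/

import Mathlib

open scoped ENNReal

noncomputable section

/-! ### Densities and their distribution functions -/

/-- The cumulative distribution function `Φ(x) = ∫_a^x φ(y) dy` of a density on `[a, b]`. -/
def cdfOn (a : ℝ) (φ : ℝ → ℝ) (x : ℝ) : ℝ := ∫ y in a..x, φ y

/-- `φ` is a probability density function on `[a, b]` with respect to Lebesgue measure whose
cumulative distribution function `Φ : [a, b] → [0, 1]` is invertible. -/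
structure IsInvertibleDensity (a b : ℝ) (φ : ℝ → ℝ) : Prop where
  nonneg : ∀ x ∈ Set.Icc a b, 0 ≤ φ x
  integrable : IntervalIntegrable φ MeasureTheory.volume a b
  integral_eq_one : ∫ y in a..b, φ y = 1
  bijOn : Set.BijOn (cdfOn a φ) (Set.Icc a b) (Set.Icc 0 1)

/-- The inverse `Φ⁻¹ : [0, 1] → [a, b]` of the cumulative distribution function. -/
def invCdfOn (a b : ℝ) (φ : ℝ → ℝ) : ℝ → ℝ := Function.invFunOn (cdfOn a φ) (Set.Icc a b)

/-! ### Mixed partial derivatives on a cube and the weighted norm -/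

/-- The partial derivative in direction `i` of a function on the cube `[a, b]`
(one-sided at the faces `x i = a i` and `x i = b i`). -/
def cubePartial {s : ℕ} (a b : Fin s → ℝ) (i : Fin s) (G : (Fin s → ℝ) → ℝ) :
    (Fin s → ℝ) → ℝ :=
  fun x => derivWithin (fun r => G (Function.update x i r)) (Set.Icc (a i) (b i)) (x i)

/-- For `u = {u₁ < u₂ < ⋯ < u_k}`, the mixed partial derivative
`∂^k F / (∂x_{u₁} ∂x_{u₂} ⋯ ∂x_{u_k}) = ∂_{u₁} (∂_{u₂} (⋯ (∂_{u_k} F)))`. -/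
def mixedPartial {s : ℕ} (a b : Fin s → ℝ) (u : Finset (Fin s)) (F : (Fin s → ℝ) → ℝ) :
    (Fin s → ℝ) → ℝ :=
  (u.sort (· ≤ ·)).foldr (cubePartial a b) F

/-- All mixed partial derivatives of `F` of order at most one in each variable exist at every
point of the cube `[a, b]`: whenever `i` is smaller than all elements of `u`, the function
`∂_u F` is differentiable in the variable `i`, so that `∂_{{i} ∪ u} F` exists. -/
def HasMixedPartials {s : ℕ} (a b : Fin s → ℝ) (F : (Fin s → ℝ) → ℝ) : Prop :=
  ∀ (u : Finset (Fin s)) (i : Fin s), (∀ j ∈ u, i < j) → ∀ x ∈ Set.Icc a b,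
    DifferentiableWithinAt ℝ (fun r => mixedPartial a b u F (Function.update x i r))
      (Set.Icc (a i) (b i)) (x i)

/-- `(∑ᵢ fᵢ ^ p) ^ (1 / p)`, and the supremum of the `fᵢ` if `p = ∞`. -/
def finLpNorm {ι : Type*} [Fintype ι] (p : ℝ≥0∞) (f : ι → ℝ≥0∞) : ℝ≥0∞ :=
  if p = ∞ then ⨆ i, f i else (∑ i, f i ^ p.toReal) ^ (1 / p.toReal)

/-- The weighted norm `‖F‖_{p, s, γ}`, with values in `[0, ∞]`. -/
def mixedNorm {s : ℕ} (a b : Fin s → ℝ) (γ : Finset (Fin s) → ℝ) (p : ℝ≥0∞)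
    (F : (Fin s → ℝ) → ℝ) : ℝ≥0∞ :=
  finLpNorm p fun u : Finset (Fin s) =>
    ENNReal.ofReal (1 / γ u) * ⨆ x ∈ Set.Icc a b, ENNReal.ofReal |mixedPartial a b u F x|

/-! ### Integration error and worst-case error -/

/-- The error of the quasi-Monte Carlo rule with nodes `Φ⁻¹(P n)`, `n < N`, for the integral of
`F` over `[a, b]` against the product density `∏ i, φ i (x i)`. -/
def qmcErr {s N : ℕ} (a b : Fin s → ℝ) (φ : Fin s → ℝ → ℝ) (P : Fin N → Fin s → ℝ)
    (F : (Fin s → ℝ) → ℝ) : ℝ :=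
  1 / (N : ℝ) * ∑ n, F (fun i => invCdfOn (a i) (b i) (φ i) (P n i))
    - ∫ x in Set.Icc a b, F x * ∏ i, φ i (x i)

/-- The worst-case error: the supremum of `|err(F)|` over all `F` with `‖F‖_{p, s, γ} ≤ 1`. -/
def wce {s N : ℕ} (a b : Fin s → ℝ) (φ : Fin s → ℝ → ℝ) (γ : Finset (Fin s) → ℝ) (p : ℝ≥0∞)
    (P : Fin N → Fin s → ℝ) : ℝ≥0∞ :=
  ⨆ (F : (Fin s → ℝ) → ℝ) (_ : HasMixedPartials a b F) (_ : mixedNorm a b γ p F ≤ 1),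
    ENNReal.ofReal |qmcErr a b φ P F|

/-! ### Digital sequences over `𝔽₂` (rows, columns and digits are indexed from `0`) -/

/-- The `m × m` matrices `C i` over `𝔽₂` generate a digital `(t, m, s)`-net, `s` being the number
of indices `i`: `t ≤ m`, and for all `d` with `∑ i, d i = m - t` the system that consists of the
first `d i` rows of `C i` for all `i` is linearly independent. -/
def GeneratesDigitalNet {ι : Type*} [Fintype ι] (t m : ℕ)
    (C : ι → Matrix (Fin m) (Fin m) (ZMod 2)) : Prop :=
  t ≤ m ∧ ∀ d : ι → ℕ, ∑ i, d i = m - t →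
    LinearIndependent (ZMod 2)
      (fun r : {r : ι × Fin m // (r.2 : ℕ) < d r.1} => C r.1.1 r.1.2)

/-- The upper left `m × m` submatrix. -/
def upperLeft (m : ℕ) (C : Matrix ℕ ℕ (ZMod 2)) : Matrix (Fin m) (Fin m) (ZMod 2) :=
  C.submatrix Fin.val Fin.val

/-- The infinite matrices `C i` generate a digital `(t, s)`-sequence over `𝔽₂`: their columns have
finitely many nonzero entries, and for all `m ≥ t` their upper left `m × m` submatrices generate a
digital `(t, m, s)`-net. -/
def GeneratesDigitalSequence {ι : Type*} [Fintype ι] (t : ℕ)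
    (C : ι → Matrix ℕ ℕ (ZMod 2)) : Prop :=
  (∀ i l, ∃ K, ∀ k, K < k → C i k l = 0) ∧
    ∀ m, t ≤ m → GeneratesDigitalNet t m fun i => upperLeft m (C i)

/-- The matrices `C i` generate a digital `((t_u)_u, s)`-sequence: for every nonempty set `u` of
coordinates, `(C i)_{i ∈ u}` generate a digital `(t_u, |u|)`-sequence. -/
def GeneratesDigitalSequenceFamily {s : ℕ} (t : Finset (Fin s) → ℕ)
    (C : Fin s → Matrix ℕ ℕ (ZMod 2)) : Prop :=
  ∀ u : Finset (Fin s), u.Nonempty → GeneratesDigitalSequence (t u) fun i : u => C i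

/-- Non-singular upper triangular infinite matrices. An upper triangular matrix has all its upper
left square submatrices invertible if and only if its diagonal entries are nonzero. -/
def IsNonsingularUpperTriangular (C : Matrix ℕ ℕ (ZMod 2)) : Prop :=
  (∀ k l, l < k → C k l = 0) ∧ ∀ k, C k k ≠ 0

/-- Row `k` of the product of `C` with the vector of binary digits of `n`. -/
def outputDigit (C : Matrix ℕ ℕ (ZMod 2)) (n k : ℕ) : ZMod 2 :=
  ∑ l ∈ Finset.range n.size, C k l * (if n.testBit l then 1 else 0)

/-- The `n`-th point of the sequence with generating matrices `C i`. -/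
def digitalPoint {s : ℕ} (C : Fin s → Matrix ℕ ℕ (ZMod 2)) (n : ℕ) : Fin s → ℝ :=
  fun i => ∑' k : ℕ, ((outputDigit (C i) n k).val : ℝ) / 2 ^ (k + 1)

end

/-! ### Mixed differences and mixed partial derivatives -/

/-! The indices `0, …, N - 1` split, along the binary digits of `N`, into at most `N.size` aligned
blocks of length `2 ^ m ≤ N`. It suffices to bound the summed error on one block by a quantity that
does not depend on its position.

Upper triangularity makes all points of a block share their digits beyond the `m`-th. A block is
therefore a digital net on the grid of mesh `2 ^ (-m)`, shifted by one common offset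
(`digitalPoint_block`). Its error is split in two by comparison with the average of `F` over the
whole shifted grid, transported by `Φ⁻¹`.

Full grid against integral (`abs_sum_sub_integral_le`): quantile boxes have equal mass, so the
average is a Riemann sum. A Lipschitz bound costs at most `∑ i, L {i} * (b i - a i)` per block.

Net against full grid (`abs_sum_cellIndex_sub_le`): for a net point `w` and a grid point `v`, let `κ
i` leading digits in direction `i` come from `w` and the others from `v`. Passing from `κ = 0` to `κ
= (m, …, m)` telescopes into mixed differences indexed by `k ∈ {0, …, m}^s`. Let `u` be the support
of `k`. If `∑ k i ≤ m - t_u`, equidistribution gives every vertex of the difference the same sum,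
and the signs cancel (`sum_sum_levelDiff_eq_zero`). Otherwise the mean value inequality bounds a
difference by `L u` times the sides of a cell of level `k - 1`. Such a cell holds at most `2 ^ (t_u
+ |u|)` net points, and the sides telescope to `∏ (b i - a i)` (`sum_prod_cellLength_le`). With `m ^
|u|` vectors `k` of support `u`, this gives `(2 * m) ^ |u| * 2 ^ t_u * L u * ∏ (b i - a i)`.

Elementary estimates turn `m` and `N.size` into logarithms, and Hölder's inequality over the sets
`u` separates the norm of `F` from the weights. -/

theorem sort_insert_of_forall_lt {s : ℕ} {u : Finset (Fin s)} {i : Fin s} (h : ∀ j ∈ u, j < i) :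
    (insert i u).sort (· ≤ ·) = u.sort (· ≤ ·) ++ [i] := by
  have hi : i ∉ u := fun hi => lt_irrefl _ (h i hi)
  refine List.Perm.eq_of_pairwise' (r := (· ≤ ·)) (Finset.pairwise_sort _ _) ?_ ?_
  · rw [List.pairwise_append]
    refine ⟨Finset.pairwise_sort _ _, List.pairwise_singleton _ _, ?_⟩
    intro x hx y hy
    rw [Finset.mem_sort] at hx
    rw [List.mem_singleton] at hy
    exact hy ▸ (h x hx).le
  · rw [List.perm_ext_iff_of_nodup (Finset.sort_nodup _ _)]
    · intro x
      simp [or_comm]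
    · rw [List.nodup_append]
      refine ⟨Finset.sort_nodup _ _, List.nodup_singleton _, ?_⟩
      intro x hx y hy hxy
      rw [Finset.mem_sort] at hx
      rw [List.mem_singleton] at hy
      exact hi (by rw [← hy, ← hxy]; exact hx)

theorem mixedPartial_empty {s : ℕ} (a b : Fin s → ℝ) (F : (Fin s → ℝ) → ℝ) :
    mixedPartial a b ∅ F = F := by
  simp [mixedPartial]

/-- `foldr` applies the last entry of the sorted list first, so the largest index is the innermost
derivative. This dictates induction on the maximum below. -/
theorem mixedPartial_insert {s : ℕ} (a b : Fin s → ℝ) {u : Finset (Fin s)} {i : Fin s}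
    (h : ∀ j ∈ u, j < i) (F : (Fin s → ℝ) → ℝ) :
    mixedPartial a b (insert i u) F = mixedPartial a b u (cubePartial a b i F) := by
  simp [mixedPartial, sort_insert_of_forall_lt h]

theorem update_mem_Icc {s : ℕ} {a b x : Fin s → ℝ} (hx : x ∈ Set.Icc a b) {i : Fin s} {r : ℝ}
    (hr : r ∈ Set.Icc (a i) (b i)) : Function.update x i r ∈ Set.Icc a b := by
  constructor <;> intro j <;> by_cases hj : j = i
  · subst hj; simpa using hr.1
  · simpa [hj] using hx.1 j
  · subst hj; simpa using hr.2
  · simpa [hj] using hx.2 j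

theorem piecewise_mem_Icc' {s : ℕ} {a b x y : Fin s → ℝ} (hx : x ∈ Set.Icc a b)
    (hy : y ∈ Set.Icc a b) (e : Finset (Fin s)) : e.piecewise x y ∈ Set.Icc a b := by
  constructor <;> intro j <;> by_cases hj : j ∈ e
  · simpa [hj] using hx.1 j
  · simpa [hj] using hy.1 j
  · simpa [hj] using hx.2 j
  · simpa [hj] using hy.2 j

/-- The alternating sum of the values of `F` at the vertices of the box spanned by `α` and `β` in
the coordinates of `u`. -/
def boxDiff {s : ℕ} (u : Finset (Fin s)) (F : (Fin s → ℝ) → ℝ) (α β : Fin s → ℝ) : ℝ :=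
  ∑ e ∈ u.powerset, (-1) ^ e.card * F (e.piecewise β α)

theorem boxDiff_insert {s : ℕ} {u : Finset (Fin s)} {i : Fin s} (hi : i ∉ u)
    (F : (Fin s → ℝ) → ℝ) (α β : Fin s → ℝ) :
    boxDiff (insert i u) F α β =
      boxDiff u (fun x => F (Function.update x i (α i))) α β
        - boxDiff u (fun x => F (Function.update x i (β i))) α β := by
  unfold boxDiff
  rw [Finset.sum_powerset_insert hi, sub_eq_add_neg, ← Finset.sum_neg_distrib]
  congr 1
  · refine Finset.sum_congr rfl fun e he => ?_
    have hie : i ∉ e := fun h => hi (Finset.mem_powerset.1 he h)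
    congr 2
    rw [eq_comm, Function.update_eq_self_iff]
    simp [hie]
  · refine Finset.sum_congr rfl fun e he => ?_
    have hie : i ∉ e := fun h => hi (Finset.mem_powerset.1 he h)
    rw [Finset.card_insert_of_notMem hie, Finset.piecewise_insert, pow_succ]
    ring

/-- Mean value inequality in the largest direction `i`, then induction applied to `cubePartial a b i
F`; no continuity of derivatives is needed. The differentiability hypothesis is confined to subsets
and elements of `u` so that it passes to `cubePartial a b i F`, about which `HasMixedPartials` says
nothing in directions above `i`. -/
theorem abs_boxDiff_le {s : ℕ} {a b : Fin s → ℝ} (u : Finset (Fin s)) :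
    ∀ (F : (Fin s → ℝ) → ℝ) (L : ℝ) {α β : Fin s → ℝ},
      (∀ v ⊆ u, ∀ i ∈ u, (∀ j ∈ v, i < j) → ∀ x ∈ Set.Icc a b,
        DifferentiableWithinAt ℝ (fun r => mixedPartial a b v F (Function.update x i r))
          (Set.Icc (a i) (b i)) (x i)) →
      (∀ x ∈ Set.Icc a b, |mixedPartial a b u F x| ≤ L) →
      α ∈ Set.Icc a b → β ∈ Set.Icc a b →
      |boxDiff u F α β| ≤ L * ∏ i ∈ u, |β i - α i| := by
  induction u using Finset.induction_on_max with
  | empty =>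
    intro F L α β _ hL hα _
    simpa [boxDiff, mixedPartial_empty] using hL α hα
  | insert i u hiu ih =>
    intro F L α β hF hL hα hβ
    have hi : i ∉ u := fun h => lt_irrefl _ (hiu i h)
    have hdiff : ∀ x ∈ Set.Icc a b, HasDerivWithinAt (fun r => F (Function.update x i r))
        (cubePartial a b i F x) (Set.Icc (a i) (b i)) (x i) := by
      intro x hx
      have := hF ∅ (by simp) i (by simp) (by simp) x hx
      rw [mixedPartial_empty] at this
      exact this.hasDerivWithinAt
    have hder : ∀ x ∈ Set.Icc a b, ∀ r ∈ Set.Icc (a i) (b i),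
        HasDerivWithinAt (fun r => F (Function.update x i r))
          (cubePartial a b i F (Function.update x i r)) (Set.Icc (a i) (b i)) r := by
      intro x hx r hr
      simpa using hdiff _ (update_mem_Icc hx hr)
    have key := Convex.norm_image_sub_le_of_norm_hasDerivWithin_le (𝕜 := ℝ)
      (f := fun r => boxDiff u (fun x => F (Function.update x i r)) α β)
      (f' := fun r => boxDiff u (fun x => cubePartial a b i F (Function.update x i r)) α β)
      (s := Set.Icc (a i) (b i)) (x := β i) (y := α i) (C := L * ∏ i ∈ u, |β i - α i|) ?_ ?_
      (convex_Icc _ _) ⟨hβ.1 i, hβ.2 i⟩ ⟨hα.1 i, hα.2 i⟩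
    · rw [boxDiff_insert hi, Finset.prod_insert hi, abs_sub_comm (β i)]
      simp only [Real.norm_eq_abs] at key
      exact key.trans (le_of_eq (by ring))
    · intro r hr
      refine HasDerivWithinAt.fun_sum fun e _ => HasDerivWithinAt.const_mul _ ?_
      exact hder _ (piecewise_mem_Icc' hβ hα e) r hr
    · intro r hr
      -- Freezing coordinate `i` at `r` in both corners leaves the sides in the directions of `u`
      -- unchanged, since `i ∉ u`.
      have h1 : boxDiff u (fun x => cubePartial a b i F (Function.update x i r)) α β =
          boxDiff u (cubePartial a b i F) (Function.update α i r) (Function.update β i r) := by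
        refine Finset.sum_congr rfl fun e he => ?_
        refine congrArg (fun y => (-1 : ℝ) ^ e.card * cubePartial a b i F y) ?_
        ext j
        by_cases hj : j = i
        · subst hj
          by_cases hje : j ∈ e <;> simp [hje]
        · by_cases hje : j ∈ e <;> simp [hje, hj]
      have h2 : ∏ i ∈ u, |β i - α i| =
          ∏ j ∈ u, |Function.update β i r j - Function.update α i r j| := by
        refine Finset.prod_congr rfl fun j hj => ?_
        have : j ≠ i := (hiu j hj).ne
        simp [this]
      rw [h1, h2, Real.norm_eq_abs]
      refine ih _ L ?_ ?_ (update_mem_Icc hα hr) (update_mem_Icc hβ hr)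
      · intro v hv j hj hjv x hx
        have hvi : ∀ k ∈ v, k < i := fun k hk => hiu k (hv hk)
        rw [← mixedPartial_insert a b hvi]
        refine hF _ (Finset.insert_subset_insert _ hv) j (Finset.mem_insert_of_mem hj) ?_ x hx
        intro k hk
        rcases Finset.mem_insert.1 hk with rfl | hk
        · exact hiu j hj
        · exact hjv k hk
      · intro x hx
        rw [← mixedPartial_insert a b hiu]
        exact hL x hx

theorem HasMixedPartials.abs_boxDiff_le {s : ℕ} {a b : Fin s → ℝ} {F : (Fin s → ℝ) → ℝ}
    (hF : HasMixedPartials a b F) {u : Finset (Fin s)} {L : ℝ}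
    (hL : ∀ x ∈ Set.Icc a b, |mixedPartial a b u F x| ≤ L) {α β : Fin s → ℝ}
    (hα : α ∈ Set.Icc a b) (hβ : β ∈ Set.Icc a b) :
    |boxDiff u F α β| ≤ L * ∏ i ∈ u, |β i - α i| :=
  _root_.abs_boxDiff_le u F L (fun v _ i _ h => hF v i h) hL hα hβ

/-- The coordinates of `y` are replaced by those of `x` one at a time; each replacement is a
one-dimensional box difference. -/
theorem HasMixedPartials.abs_sub_le {s : ℕ} {a b : Fin s → ℝ} {F : (Fin s → ℝ) → ℝ}
    (hF : HasMixedPartials a b F) {L : Finset (Fin s) → ℝ}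
    (hL : ∀ u, ∀ x ∈ Set.Icc a b, |mixedPartial a b u F x| ≤ L u) {x y : Fin s → ℝ}
    (hx : x ∈ Set.Icc a b) (hy : y ∈ Set.Icc a b) :
    |F x - F y| ≤ ∑ i, L {i} * |x i - y i| := by
  have key : ∀ A : Finset (Fin s), |F (A.piecewise x y) - F y| ≤ ∑ i ∈ A, L {i} * |x i - y i| := by
    intro A
    induction A using Finset.induction_on with
    | empty => simp
    | insert i A hi ih =>
      have h := hF.abs_boxDiff_le (hL {i}) (piecewise_mem_Icc' hx hy A)
        (update_mem_Icc (piecewise_mem_Icc' hx hy A) ⟨hx.1 i, hx.2 i⟩)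
      rw [← insert_empty_eq, boxDiff_insert (by simp)] at h
      simp only [boxDiff, Finset.powerset_empty, Finset.sum_singleton, Finset.card_empty, pow_zero,
        one_mul, Finset.piecewise_empty, Function.update_self,
        insert_empty_eq, Finset.prod_singleton, Finset.piecewise_eq_of_notMem _ _ _ hi] at h
      have hu : Function.update (A.piecewise x y) i (y i) = A.piecewise x y := by
        rw [Function.update_eq_self_iff, Finset.piecewise_eq_of_notMem _ _ _ hi]
      rw [abs_sub_comm, hu] at h
      rw [Finset.sum_insert hi, Finset.piecewise_insert]
      calc _ ≤ _ := _root_.abs_sub_le _ (F (A.piecewise x y)) _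
        _ ≤ _ := add_le_add h ih
  simpa using key Finset.univ

theorem HasMixedPartials.continuousOn {s : ℕ} {a b : Fin s → ℝ} {F : (Fin s → ℝ) → ℝ}
    (hF : HasMixedPartials a b F) {L : Finset (Fin s) → ℝ}
    (hL : ∀ u, ∀ x ∈ Set.Icc a b, |mixedPartial a b u F x| ≤ L u) :
    ContinuousOn F (Set.Icc a b) := by
  intro y hy
  refine tendsto_iff_dist_tendsto_zero.2 ?_
  have h : Filter.Tendsto (fun x : Fin s → ℝ => ∑ i, L {i} * |x i - y i|)
      (nhdsWithin y (Set.Icc a b)) (nhds 0) := by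
    have : Continuous fun x : Fin s → ℝ => ∑ i, L {i} * |x i - y i| := by fun_prop
    simpa using (this.tendsto y).mono_left nhdsWithin_le_nhds
  refine squeeze_zero' (Filter.Eventually.of_forall fun x => dist_nonneg) ?_ h
  filter_upwards [self_mem_nhdsWithin] with x hx
  rw [Real.dist_eq]
  exact hF.abs_sub_le hL hx hy

/-! ### Telescoping over levels and averages over grids -/

/-- Point evaluations become indicators that factor over the coordinates, which reduces the
multivariate identities below to one-dimensional ones. -/
theorem sum_mul_eq_sum_mul_prod_ite {ι : Type*} {s : ℕ} (A : Finset ι) (w : ι → ℝ)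
    (p : ι → Fin s → ℕ) {S : Finset (Fin s → ℕ)} (hp : ∀ a ∈ A, p a ∈ S)
    (G : (Fin s → ℕ) → ℝ) :
    ∑ a ∈ A, w a * G (p a) =
      ∑ x ∈ S, G x * ∑ a ∈ A, w a * ∏ i, if p a i = x i then 1 else 0 := by
  simp_rw [Finset.mul_sum]
  rw [Finset.sum_comm]
  refine Finset.sum_congr rfl fun a ha => ?_
  rw [Finset.sum_eq_single_of_mem (p a) (hp a ha)]
  · simp [mul_comm]
  · intro x _ hx
    obtain ⟨i, hi⟩ := Function.ne_iff.1 hx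
    rw [Finset.prod_eq_zero (Finset.mem_univ i), mul_zero, mul_zero]
    simp [hi.symm]

/-- The set of indices at which `k` is nonzero. -/
def levelSupport {s : ℕ} (k : Fin s → ℕ) : Finset (Fin s) := Finset.univ.filter (k · ≠ 0)

theorem mem_levelSupport {s : ℕ} {k : Fin s → ℕ} {i : Fin s} : i ∈ levelSupport k ↔ k i ≠ 0 := by
  simp [levelSupport]

/-- The mixed backward difference of `G` at `k` in all coordinates where `k` is nonzero. -/
def levelDiff {s : ℕ} (k : Fin s → ℕ) (G : (Fin s → ℕ) → ℝ) : ℝ :=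
  ∑ e ∈ (levelSupport k).powerset, (-1) ^ e.card * G (e.piecewise (fun i => k i - 1) k)

/-- As a weight on `x`, the mixed difference is the product over `i` of `1_{k i = x i} - 1_{k i - 1
= x i}`, the second indicator being dropped for `k i = 0`. Each factor telescopes in `k i`. -/
theorem sum_levelDiff {s : ℕ} (m : ℕ) (G : (Fin s → ℕ) → ℝ) :
    ∑ k ∈ Fintype.piFinset fun _ : Fin s => Finset.range (m + 1), levelDiff k G =
      G fun _ => m := by
  set S := Fintype.piFinset fun _ : Fin s => Finset.range (m + 1) with hS
  have h1 : ∀ k ∈ S, levelDiff k G = ∑ x ∈ S, G x *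
      ∏ i, ((if k i = x i then (1 : ℝ) else 0) -
        if k i = 0 then 0 else if k i - 1 = x i then 1 else 0) := by
    intro k hk
    unfold levelDiff
    rw [sum_mul_eq_sum_mul_prod_ite (S := S)]
    · refine Finset.sum_congr rfl fun x _ => ?_
      congr 1
      simp_rw [sub_eq_neg_add]
      rw [Finset.prod_add]
      -- The expanded product runs over all sets of coordinates; those not contained in the support
      -- contain a factor zero.
      refine Finset.sum_subset_zero_on_sdiff (Finset.powerset_mono.2 (Finset.subset_univ _)) ?_ ?_
      · intro e he
        simp only [Finset.mem_sdiff, Finset.mem_powerset, Finset.subset_univ, true_and] at he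
        obtain ⟨i, hie, hi⟩ := Finset.not_subset.1 he
        rw [Finset.prod_eq_zero hie, zero_mul]
        rw [mem_levelSupport, not_not] at hi
        simp [hi]
      · intro e he
        rw [← Finset.prod_mul_prod_compl e, ← mul_assoc, Finset.compl_eq_univ_sdiff]
        congr 1
        · rw [← Finset.prod_const, ← Finset.prod_mul_distrib]
          refine Finset.prod_congr rfl fun i hi => ?_
          have := mem_levelSupport.1 (Finset.mem_powerset.1 he hi)
          simp only [hi, Finset.piecewise_eq_of_mem, this, if_false]
          split_ifs <;> simp
        · refine Finset.prod_congr rfl fun i hi => ?_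
          simp [(Finset.mem_sdiff.1 hi).2]
    · intro e _
      rw [hS, Fintype.mem_piFinset] at hk ⊢
      intro i
      have := Finset.mem_range.1 (hk i)
      by_cases hi : i ∈ e
      · simp [hi]; omega
      · simp [hi, this]
  rw [Finset.sum_congr rfl h1, Finset.sum_comm]
  have h2 : ∀ x ∈ S, (∑ k ∈ S, G x * ∏ i, ((if k i = x i then (1 : ℝ) else 0) -
        if k i = 0 then 0 else if k i - 1 = x i then 1 else 0)) =
      G x * ∏ i, if m = x i then 1 else 0 := by
    intro x _
    rw [← Finset.mul_sum, hS, ← Finset.prod_univ_sum (fun _ : Fin s => Finset.range (m + 1))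
      (fun i j => (if j = x i then (1 : ℝ) else 0) -
        if j = 0 then 0 else if j - 1 = x i then 1 else 0)]
    congr 1
    refine Finset.prod_congr rfl fun i _ => ?_
    rw [Finset.sum_range_succ']
    simp only [Nat.add_eq_zero_iff, one_ne_zero, and_false, if_false, Nat.add_sub_cancel, if_true,
      sub_zero]
    rw [Finset.sum_range_sub (fun j => if j = x i then (1 : ℝ) else 0)]
    ring
  rw [Finset.sum_congr rfl h2, Finset.sum_eq_single_of_mem (fun _ => m)]
  · simp
  · simp [hS]
  · intro x _ hx
    obtain ⟨i, hi⟩ := Function.ne_iff.1 hx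
    rw [Finset.prod_eq_zero (Finset.mem_univ i), mul_zero]
    simp [hi.symm]

/-- The leading digits of `x` determine `c`, and the trailing ones determine `v` modulo `2 ^ (m -
κ)`, which leaves `2 ^ κ` choices of `v`. -/
theorem sum_sum_ite_add_mod {m κ x : ℕ} (hκ : κ ≤ m) (hx : x < 2 ^ m) :
    ∑ c ∈ Finset.range (2 ^ κ), ∑ v ∈ Finset.range (2 ^ m),
      (if c * 2 ^ (m - κ) + v % 2 ^ (m - κ) = x then (1 : ℝ) else 0) = 2 ^ κ := by
  have hpos : 0 < 2 ^ (m - κ) := by positivity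
  have hmul : 2 ^ m = 2 ^ (m - κ) * 2 ^ κ := by rw [← pow_add, Nat.sub_add_cancel hκ]
  have h : ∀ c v : ℕ, c * 2 ^ (m - κ) + v % 2 ^ (m - κ) = x ↔
      c = x / 2 ^ (m - κ) ∧ v ≡ x [MOD 2 ^ (m - κ)] := by
    intro c v
    have hv := Nat.mod_lt v hpos
    constructor
    · rintro rfl
      constructor
      · rw [add_comm, Nat.add_mul_div_right _ _ hpos, Nat.div_eq_of_lt hv, zero_add]
      · simp [Nat.ModEq]
    · rintro ⟨rfl, h⟩
      rw [h, mul_comm]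
      exact Nat.div_add_mod _ _
  have hc : x / 2 ^ (m - κ) < 2 ^ κ := Nat.div_lt_of_lt_mul (hmul ▸ hx)
  rw [Finset.sum_eq_single_of_mem (x / 2 ^ (m - κ)) (Finset.mem_range.2 hc)]
  · simp_rw [h, true_and]
    rw [Finset.sum_boole, ← Nat.count_eq_card_filter_range, Nat.count_modEq_card _ hpos, hmul]
    simp
  · intro c _ hne
    refine Finset.sum_eq_zero fun v _ => if_neg fun h' => hne ((h c v).1 h').1

theorem sum_sum_add_mod {s m : ℕ} {κ : Fin s → ℕ} (hκ : ∀ i, κ i ≤ m)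
    (g : (Fin s → ℕ) → ℝ) :
    ∑ c ∈ Fintype.piFinset fun i => Finset.range (2 ^ κ i),
      ∑ v ∈ Fintype.piFinset fun _ : Fin s => Finset.range (2 ^ m),
        g (fun i => c i * 2 ^ (m - κ i) + v i % 2 ^ (m - κ i)) =
      2 ^ (∑ i, κ i) * ∑ v ∈ Fintype.piFinset fun _ : Fin s => Finset.range (2 ^ m), g v := by
  set V := Fintype.piFinset fun _ : Fin s => Finset.range (2 ^ m) with hV
  set K := Fintype.piFinset fun i => Finset.range (2 ^ κ i) with hK
  have h := sum_mul_eq_sum_mul_prod_ite (K ×ˢ V) (fun _ => 1)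
    (fun cv i => cv.1 i * 2 ^ (m - κ i) + cv.2 i % 2 ^ (m - κ i)) (S := V) ?_ g
  · simp only [one_mul, Finset.sum_product] at h
    rw [h, Finset.mul_sum]
    refine Finset.sum_congr rfl fun x hx => ?_
    rw [mul_comm]
    congr 1
    have : ∀ c ∈ K, ∑ v ∈ V, ∏ i,
        (if c i * 2 ^ (m - κ i) + v i % 2 ^ (m - κ i) = x i then (1 : ℝ) else 0) =
        ∏ i, ∑ v ∈ Finset.range (2 ^ m),
          (if c i * 2 ^ (m - κ i) + v % 2 ^ (m - κ i) = x i then (1 : ℝ) else 0) := by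
      intro c _
      rw [hV, Finset.prod_univ_sum]
    rw [Finset.sum_congr rfl this, hK, ← Finset.prod_univ_sum (fun i => Finset.range (2 ^ κ i))
      (fun i c => ∑ v ∈ Finset.range (2 ^ m),
          (if c * 2 ^ (m - κ i) + v % 2 ^ (m - κ i) = x i then (1 : ℝ) else 0)),
      ← Finset.prod_pow_eq_pow_sum]
    refine Finset.prod_congr rfl fun i _ => ?_
    rw [hV, Fintype.mem_piFinset] at hx
    exact sum_sum_ite_add_mod (hκ i) (Finset.mem_range.1 (hx i))
  · intro cv hcv
    rw [Finset.mem_product, hK, hV, Fintype.mem_piFinset] at hcv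
    rw [hV, Fintype.mem_piFinset]
    intro i
    have h1 := Finset.mem_range.1 (hcv.1 i)
    rw [Finset.mem_range]
    have hpos : 0 < 2 ^ (m - κ i) := by positivity
    calc _ < cv.1 i * 2 ^ (m - κ i) + 2 ^ (m - κ i) := by
          gcongr; exact Nat.mod_lt _ hpos
      _ = (cv.1 i + 1) * 2 ^ (m - κ i) := by ring
      _ ≤ 2 ^ κ i * 2 ^ (m - κ i) := by gcongr; omega
      _ = 2 ^ m := by rw [← pow_add, Nat.add_sub_cancel' (hκ i)]

/-- The number with the first `k` of `m` binary digits from `w` and the other ones from `v`. -/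
def mixDigits (m k w v : ℕ) : ℕ := w / 2 ^ (m - k) * 2 ^ (m - k) + v % 2 ^ (m - k)

theorem mixDigits_zero {m w v : ℕ} (hw : w < 2 ^ m) (hv : v < 2 ^ m) : mixDigits m 0 w v = v := by
  simp [mixDigits, Nat.div_eq_of_lt hw, Nat.mod_eq_of_lt hv]

theorem mixDigits_self (m w v : ℕ) : mixDigits m m w v = w := by
  simp [mixDigits, Nat.mod_one]

theorem mixDigits_div {m k d : ℕ} (hdk : d ≤ k) (hkm : k ≤ m) (w v : ℕ) :
    mixDigits m k w v / 2 ^ (m - d) = w / 2 ^ (m - d) := by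
  have h : m - d = (m - k) + (k - d) := by omega
  have hpos : 0 < 2 ^ (m - k) := by positivity
  rw [h, pow_add, ← Nat.div_div_eq_div_mul, ← Nat.div_div_eq_div_mul, mixDigits, add_comm,
    Nat.add_mul_div_right _ _ hpos, Nat.div_eq_of_lt (Nat.mod_lt _ hpos), zero_add]

theorem mixDigits_lt {m k w v : ℕ} (hk : k ≤ m) (hw : w < 2 ^ m) : mixDigits m k w v < 2 ^ m := by
  have := mixDigits_div (Nat.zero_le k) hk w v
  rw [Nat.sub_zero, Nat.div_eq_of_lt hw] at this
  exact (Nat.div_eq_zero_iff.1 this).resolve_left (by positivity)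

/-- Only the leading `κ i` digits of `W r i` matter. If all prefixes are equally frequent, averaging
over `v` erases every other trace of `W`. -/
theorem sum_sum_mixDigits {ι : Type*} {s m K : ℕ} {κ : Fin s → ℕ} (hκ : ∀ i, κ i ≤ m)
    {R : Finset ι} {W : ι → Fin s → ℕ} (hW : ∀ r ∈ R, ∀ i, W r i < 2 ^ m)
    (hcard : ∀ c ∈ Fintype.piFinset fun i => Finset.range (2 ^ κ i),
      (R.filter fun r => (fun i => W r i / 2 ^ (m - κ i)) = c).card = K)
    (g : (Fin s → ℕ) → ℝ) :
    ∑ r ∈ R, ∑ v ∈ Fintype.piFinset fun _ : Fin s => Finset.range (2 ^ m),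
        g (fun i => mixDigits m (κ i) (W r i) (v i)) =
      K * 2 ^ (∑ i, κ i) *
        ∑ v ∈ Fintype.piFinset fun _ : Fin s => Finset.range (2 ^ m), g v := by
  have hmaps : ∀ r ∈ R, (fun i => W r i / 2 ^ (m - κ i)) ∈
      Fintype.piFinset fun i => Finset.range (2 ^ κ i) := by
    intro r hr
    rw [Fintype.mem_piFinset]
    intro i
    rw [Finset.mem_range]
    refine Nat.div_lt_of_lt_mul ?_
    rw [← pow_add, Nat.sub_add_cancel (hκ i)]
    exact hW r hr i
  rw [← Finset.sum_fiberwise_of_maps_to hmaps, mul_assoc, ← sum_sum_add_mod hκ, Finset.mul_sum]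
  refine Finset.sum_congr rfl fun c hc => ?_
  have : ∀ r ∈ R.filter fun r => (fun i => W r i / 2 ^ (m - κ i)) = c,
      ∑ v ∈ Fintype.piFinset fun _ : Fin s => Finset.range (2 ^ m),
        g (fun i => mixDigits m (κ i) (W r i) (v i)) =
      ∑ v ∈ Fintype.piFinset fun _ : Fin s => Finset.range (2 ^ m),
        g (fun i => c i * 2 ^ (m - κ i) + v i % 2 ^ (m - κ i)) := by
    intro r hr
    rw [← (Finset.mem_filter.1 hr).2]
    rfl
  rw [Finset.sum_congr rfl this, Finset.sum_const, hcard c hc, nsmul_eq_mul]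

/-! ### Binary prefixes -/

/-- The number with binary digits `y 0, …, y (k - 1)`, the most significant one first. -/
def prefixNum (y : ℕ → ZMod 2) : ℕ → ℕ
  | 0 => 0
  | k + 1 => prefixNum y k * 2 + (y k).val

theorem zmod_two_val_lt (x : ZMod 2) : x.val < 2 := ZMod.val_lt x

theorem prefixNum_lt (y : ℕ → ZMod 2) (k : ℕ) : prefixNum y k < 2 ^ k := by
  induction k with
  | zero => simp [prefixNum]
  | succ k ih =>
    have := zmod_two_val_lt (y k)
    rw [prefixNum, pow_succ]
    omega

theorem prefixNum_add_div (y : ℕ → ZMod 2) (k j : ℕ) :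
    prefixNum y (k + j) / 2 ^ j = prefixNum y k := by
  induction j with
  | zero => simp
  | succ j ih =>
    have := zmod_two_val_lt (y (k + j))
    rw [← ih, pow_succ', ← Nat.div_div_eq_div_mul, ← add_assoc, prefixNum]
    congr 1
    omega

theorem prefixNum_div (y : ℕ → ZMod 2) {k m : ℕ} (h : k ≤ m) :
    prefixNum y m / 2 ^ (m - k) = prefixNum y k := by
  have := prefixNum_add_div y k (m - k)
  rwa [Nat.add_sub_cancel' h] at this

theorem prefixNum_cast_div (y : ℕ → ZMod 2) (k : ℕ) :
    (prefixNum y k : ℝ) / 2 ^ k = ∑ j ∈ Finset.range k, ((y j).val : ℝ) / 2 ^ (j + 1) := by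
  induction k with
  | zero => simp [prefixNum]
  | succ k ih =>
    rw [Finset.sum_range_succ, ← ih, prefixNum]
    push_cast
    field_simp
    ring

theorem prefixNum_eq_iff {y y' : ℕ → ZMod 2} {k : ℕ} :
    prefixNum y k = prefixNum y' k ↔ ∀ j < k, y j = y' j := by
  induction k with
  | zero => simp [prefixNum]
  | succ k ih =>
    rw [Nat.forall_lt_succ_right, ← ih, prefixNum, prefixNum]
    have h1 := zmod_two_val_lt (y k)
    have h2 := zmod_two_val_lt (y' k)
    rw [← (ZMod.val_injective 2).eq_iff]
    omega

theorem exists_prefixNum_eq {k c : ℕ} (hc : c < 2 ^ k) : ∃ y, prefixNum y k = c := by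
  induction k generalizing c with
  | zero => exact ⟨0, by simp [prefixNum]; simp at hc; exact hc.symm⟩
  | succ k ih =>
    rw [pow_succ] at hc
    obtain ⟨y, hy⟩ := ih (c := c / 2) (by omega)
    refine ⟨Function.update y k ((c % 2 : ℕ) : ZMod 2), ?_⟩
    have h : prefixNum (Function.update y k ((c % 2 : ℕ) : ZMod 2)) k = prefixNum y k :=
      prefixNum_eq_iff.2 fun j hj => by simp [hj.ne]
    rw [prefixNum, h, hy, Function.update_self, ZMod.val_natCast]
    omega

/-! ### Output digits -/

/-- The `l`-th binary digit of `n`. -/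
def bitVec (n l : ℕ) : ZMod 2 := if n.testBit l then 1 else 0

theorem outputDigit_eq_sum (C : Matrix ℕ ℕ (ZMod 2)) {n L : ℕ} (hL : n.size ≤ L) (k : ℕ) :
    outputDigit C n k = ∑ l ∈ Finset.range L, C k l * bitVec n l := by
  refine Finset.sum_subset (Finset.range_mono hL) fun l _ hl => ?_
  rw [Finset.mem_range, not_lt, Nat.size_le] at hl
  simp [Nat.testBit_lt_two_pow hl]

/-- The binary digits of `2 ^ m * q` and of `r < 2 ^ m` occupy disjoint positions, so no carry
occurs and linearity applies. -/
theorem outputDigit_add (C : Matrix ℕ ℕ (ZMod 2)) {m r : ℕ} (q : ℕ) (hr : r < 2 ^ m) (k : ℕ) :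
    outputDigit C (2 ^ m * q + r) k = outputDigit C (2 ^ m * q) k + outputDigit C r k := by
  have h1 : (2 ^ m * q).size ≤ (2 ^ m * q + r).size := Nat.size_le_size (Nat.le_add_right _ _)
  have h2 : r.size ≤ (2 ^ m * q + r).size := Nat.size_le_size (Nat.le_add_left _ _)
  rw [outputDigit_eq_sum C le_rfl, outputDigit_eq_sum C h1, outputDigit_eq_sum C h2,
    ← Finset.sum_add_distrib]
  refine Finset.sum_congr rfl fun l _ => ?_
  rw [← mul_add]
  congr 1
  have h0 := Nat.testBit_two_pow_mul_add q (Nat.two_pow_pos m) l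
  rw [add_zero] at h0
  rw [bitVec, bitVec, bitVec, Nat.testBit_two_pow_mul_add q hr, h0]
  by_cases hl : l < m
  · simp [hl]
  · have : r.testBit l = false :=
      Nat.testBit_lt_two_pow (hr.trans_le (Nat.pow_le_pow_right two_pos (not_lt.1 hl)))
    simp [hl, this]

theorem outputDigit_eq_zero {C : Matrix ℕ ℕ (ZMod 2)} (hC : ∀ k l, l < k → C k l = 0)
    {m r k : ℕ} (hr : r < 2 ^ m) (hk : m ≤ k) : outputDigit C r k = 0 := by
  rw [outputDigit_eq_sum C (Nat.size_le.2 hr)]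
  refine Finset.sum_eq_zero fun l hl => ?_
  rw [hC k l ((Finset.mem_range.1 hl).trans_le hk), zero_mul]

/-! ### Points of a net in elementary boxes -/

/-- Independent rows make the map surjective, and all fibres of a surjective homomorphism have the
same size. -/
theorem card_filter_mulVec_eq {ι : Type*} [Fintype ι] [DecidableEq ι] {m : ℕ}
    (A : Matrix ι (Fin m) (ZMod 2)) (hA : LinearIndependent (ZMod 2) A) (y : ι → ZMod 2) :
    (Finset.univ.filter fun x => A.mulVec x = y).card = 2 ^ (m - Fintype.card ι) := by
  have hrank : A.rank = Fintype.card ι := LinearIndependent.rank_matrix hA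
  have hsurj : Function.Surjective A.mulVecLin := by
    rw [← LinearMap.range_eq_top]
    refine Submodule.eq_top_of_finrank_eq ?_
    rw [Module.finrank_fintype_fun_eq_card]
    exact hrank
  have hle : Fintype.card ι ≤ m := by
    rw [← hrank]; simpa using A.rank_le_card_width
  have hfib : ∀ z, (Finset.univ.filter fun x => A.mulVec x = z).card =
      (Finset.univ.filter fun x => A.mulVec x = y).card := fun z =>
    AddMonoidHom.card_fiber_eq_of_mem_range (A.mulVecLin.toAddMonoidHom) (hsurj z) (hsurj y)
  have htot := Finset.card_eq_sum_card_fiberwise (s := Finset.univ) (t := Finset.univ)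
    (f := fun x : Fin m → ZMod 2 => A.mulVec x) (by simp [Set.MapsTo])
  rw [Finset.sum_congr rfl fun z _ => hfib z, Finset.sum_const, Finset.card_univ,
    Finset.card_univ, Fintype.card_fun, Fintype.card_fun, ZMod.card, Fintype.card_fin,
    smul_eq_mul] at htot
  refine Nat.eq_of_mul_eq_mul_left (pow_pos two_pos (Fintype.card ι)) ?_
  rw [← htot, ← pow_add, Nat.add_sub_cancel' hle]

theorem card_filter_range_bitVec {m : ℕ} (p : (Fin m → ZMod 2) → Prop) [DecidablePred p] :
    ((Finset.range (2 ^ m)).filter fun r => p fun l : Fin m => bitVec r l).card =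
      (Finset.univ.filter p).card := by
  have hinj : Set.InjOn (fun r (l : Fin m) => bitVec r l) (Finset.range (2 ^ m)) := by
    intro r hr r' hr' h
    rw [Finset.coe_range, Set.mem_Iio] at hr hr'
    refine Nat.eq_of_testBit_eq fun l => ?_
    by_cases hl : l < m
    · have := congrFun h ⟨l, hl⟩
      simp only [bitVec] at this
      cases h1 : r.testBit l <;> cases h2 : r'.testBit l <;> simp [h1, h2] at this ⊢
    · rw [Nat.testBit_lt_two_pow (hr.trans_le (Nat.pow_le_pow_right two_pos (not_lt.1 hl))),
        Nat.testBit_lt_two_pow (hr'.trans_le (Nat.pow_le_pow_right two_pos (not_lt.1 hl)))]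
  have himg : (Finset.range (2 ^ m)).image (fun r (l : Fin m) => bitVec r l) = Finset.univ := by
    refine Finset.eq_univ_of_card _ ?_
    rw [Finset.card_image_of_injOn hinj]
    simp
  rw [← himg, Finset.filter_image, Finset.card_image_of_injOn]
  exact hinj.mono (Finset.coe_subset.2 (Finset.filter_subset _ _))

theorem exists_le_sum_eq {ι : Type*} [Fintype ι] [DecidableEq ι] (d : ι → ℕ) {S : ℕ}
    (hS : S ≤ ∑ i, d i) : ∃ d' : ι → ℕ, d' ≤ d ∧ ∑ i, d' i = S := by
  induction h : ∑ i, d i - S generalizing d with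
  | zero => exact ⟨d, le_rfl, by omega⟩
  | succ n ih =>
    obtain ⟨i, _, hi⟩ : ∃ i ∈ Finset.univ, d i ≠ 0 := by
      by_contra! h0
      rw [Finset.sum_eq_zero h0] at h
      omega
    have hsum : ∑ j, Function.update d i (d i - 1) j + 1 = ∑ j, d j := by
      rw [Finset.sum_update_of_mem (Finset.mem_univ i),
        ← Finset.add_sum_erase _ d (Finset.mem_univ i), Finset.sdiff_singleton_eq_erase]
      omega
    obtain ⟨d', hd', hs⟩ := ih (Function.update d i (d i - 1)) (by omega) (by omega)
    refine ⟨d', hd'.trans ?_, hs⟩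
    rw [update_le_iff]
    simp

/-- The index of the cell of level `m` in direction `i` that contains the `r`-th point of the
`q`-th block of length `2 ^ m`. -/
def cellIndex {s : ℕ} (C : Fin s → Matrix ℕ ℕ (ZMod 2)) (m q r : ℕ) (i : Fin s) : ℕ :=
  prefixNum (outputDigit (C i) (2 ^ m * q + r)) m

theorem cellIndex_lt {s : ℕ} (C : Fin s → Matrix ℕ ℕ (ZMod 2)) (m q r : ℕ) (i : Fin s) :
    cellIndex C m q r i < 2 ^ m := prefixNum_lt _ _

/-- Prescribing `d i` leading digits is a linear system in the digits of `r`, with right-hand side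
shifted by the contribution of `2 ^ m * q`. The larger vector `e` is present because the net
property is stated only for row counts of sum exactly `m - t`; its rows include those of `d`. -/
theorem card_cellIndex_eq_of_sum_eq {s t m : ℕ} {C : Fin s → Matrix ℕ ℕ (ZMod 2)} (q : ℕ)
    {u : Finset (Fin s)} (hC : GeneratesDigitalNet t m fun i : u => upperLeft m (C i))
    {d e : Fin s → ℕ} (hd : ∀ i, i ∉ u → d i = 0) (hde : d ≤ e)
    (he : ∀ i, i ∉ u → e i = 0) (hsum : ∑ i, e i = m - t)
    {c : Fin s → ℕ} (hc : ∀ i, c i < 2 ^ d i) :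
    ((Finset.range (2 ^ m)).filter fun r => (fun i => cellIndex C m q r i / 2 ^ (m - d i)) = c).card
      = 2 ^ (m - ∑ i, d i) := by
  have hem : ∀ i, e i ≤ m := fun i =>
    ((Finset.single_le_sum (fun j _ => Nat.zero_le (e j)) (Finset.mem_univ i)).trans
      hsum.le).trans (Nat.sub_le _ _)
  have hdm : ∀ i, d i ≤ m := fun i => (hde i).trans (hem i)
  choose y hy using fun i => exists_prefixNum_eq (hc i)
  have hLI := hC.2 (fun i => e i) (by
    rw [← hsum, ← Finset.sum_subset (Finset.subset_univ u) (fun i _ hi => he i hi)]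
    exact Finset.sum_coe_sort u e)
  let A : Matrix ((i : u) × Fin (d i)) (Fin m) (ZMod 2) := fun x l => C x.1 x.2 l
  have hA : LinearIndependent (ZMod 2) A := by
    refine hLI.comp (fun x : (i : u) × Fin (d i) =>
      ⟨(x.1, ⟨x.2, x.2.2.trans_le (hdm x.1)⟩), x.2.2.trans_le (hde x.1)⟩) ?_
    rintro ⟨i, j⟩ ⟨i', j'⟩ h
    simp only [Subtype.mk.injEq, Prod.mk.injEq, Fin.mk.injEq] at h
    obtain ⟨rfl, h⟩ := h
    rw [Fin.ext h]
  have hcard : Fintype.card ((i : u) × Fin (d i)) = ∑ i, d i := by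
    rw [Fintype.card_sigma, ← Finset.sum_subset (Finset.subset_univ u) (fun i _ hi => hd i hi)]
    simp only [Fintype.card_fin]
    exact Finset.sum_coe_sort u d
  rw [← hcard, ← card_filter_mulVec_eq A hA
    (fun x => y x.1 x.2 - outputDigit (C x.1) (2 ^ m * q) x.2), ← card_filter_range_bitVec]
  congr 1
  refine Finset.filter_congr fun r hr => ?_
  rw [Finset.mem_range] at hr
  have hdig : ∀ i k, outputDigit (C i) r k = ∑ l : Fin m, C i k l * bitVec r l := fun i k => by
    rw [outputDigit_eq_sum _ (Nat.size_le.2 hr), Finset.sum_range]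
  have hcell : ∀ i, cellIndex C m q r i / 2 ^ (m - d i) = c i ↔
      ∀ j < d i, ∑ l : Fin m, C i j l * bitVec r l =
        y i j - outputDigit (C i) (2 ^ m * q) j := by
    intro i
    rw [cellIndex, prefixNum_div _ (hdm i), ← hy i, prefixNum_eq_iff]
    refine forall₂_congr fun j _ => ?_
    rw [outputDigit_add _ _ hr, hdig, eq_sub_iff_add_eq']
  rw [funext_iff, funext_iff]
  simp only [hcell]
  constructor
  · intro h x
    exact h x.1 x.2 x.2.2
  · intro h i j hj
    by_cases hi : i ∈ u
    · exact h ⟨⟨i, hi⟩, ⟨j, hj⟩⟩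
    · rw [hd i hi] at hj
      exact absurd hj (Nat.not_lt_zero _)

theorem card_cellIndex_eq {s t m : ℕ} {C : Fin s → Matrix ℕ ℕ (ZMod 2)} (q : ℕ)
    {u : Finset (Fin s)} (hu : u.Nonempty)
    (hC : GeneratesDigitalNet t m fun i : u => upperLeft m (C i))
    {d : Fin s → ℕ} (hd : ∀ i, i ∉ u → d i = 0) (hsum : ∑ i, d i ≤ m - t)
    {c : Fin s → ℕ} (hc : ∀ i, c i < 2 ^ d i) :
    ((Finset.range (2 ^ m)).filter fun r => (fun i => cellIndex C m q r i / 2 ^ (m - d i)) = c).card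
      = 2 ^ (m - ∑ i, d i) := by
  obtain ⟨i, hi⟩ := hu
  -- The whole deficit `m - t - ∑ i, d i` is put into one direction of `u`.
  have hle : d ≤ Function.update d i (d i + (m - t - ∑ i, d i)) := by
    rw [le_update_iff]
    simp
  refine card_cellIndex_eq_of_sum_eq q hC hd hle ?_ ?_ hc
  · intro j hj
    have : j ≠ i := fun h => hj (h ▸ hi)
    simp [this, hd j hj]
  · rw [Finset.sum_update_of_mem (Finset.mem_univ i), Finset.sdiff_singleton_eq_erase, add_right_comm,
      Finset.add_sum_erase _ d (Finset.mem_univ i), Nat.add_sub_cancel' hsum]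

/-- Three regimes: for `m < t` the block itself is small enough; for `∑ i, d i ≤ m - t` the count is
exact; a finer cell lies in a coarser one of total level `m - t`, which contains `2 ^ t` points. -/
theorem card_cellIndex_le {s t m : ℕ} {C : Fin s → Matrix ℕ ℕ (ZMod 2)} (q : ℕ)
    {u : Finset (Fin s)} (hu : u.Nonempty)
    (hC : t ≤ m → GeneratesDigitalNet t m fun i : u => upperLeft m (C i))
    {d : Fin s → ℕ} (hd : ∀ i, i ∉ u → d i = 0) (hdm : ∀ i, d i ≤ m)
    (hsum : m ≤ t + (∑ i, d i + u.card)) {c : Fin s → ℕ} (hc : ∀ i, c i < 2 ^ d i) :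
    ((Finset.range (2 ^ m)).filter fun r => (fun i => cellIndex C m q r i / 2 ^ (m - d i)) = c).card
      ≤ 2 ^ (t + u.card) := by
  rcases lt_or_ge m t with hmt | htm
  · refine (Finset.card_filter_le _ _).trans ?_
    rw [Finset.card_range]
    exact Nat.pow_le_pow_right two_pos (by omega)
  rcases le_or_gt (∑ i, d i) (m - t) with h | h
  · rw [card_cellIndex_eq q hu (hC htm) hd h hc]
    exact Nat.pow_le_pow_right two_pos (by omega)
  · obtain ⟨d', hd', hs⟩ := exists_le_sum_eq d h.le
    have hc' : ∀ i, c i / 2 ^ (d i - d' i) < 2 ^ d' i := by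
      intro i
      refine Nat.div_lt_of_lt_mul ?_
      rw [← pow_add, Nat.sub_add_cancel (hd' i)]
      exact hc i
    have hcard := card_cellIndex_eq q hu (hC htm)
      (fun i hi => Nat.le_zero.1 ((hd' i).trans (hd i hi).le)) hs.le hc'
    refine (Finset.card_le_card ?_).trans (hcard.trans_le ?_)
    · intro r
      simp only [Finset.mem_filter]
      refine And.imp_right ?_
      rintro rfl
      ext i
      have : m - d' i = (m - d i) + (d i - d' i) := by
        have := hdm i
        have := hd' i
        simp only at this
        omega
      rw [this, pow_add, Nat.div_div_eq_div_mul]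
    · exact Nat.pow_le_pow_right two_pos (by omega)

/-! ### Quantiles -/

namespace IsInvertibleDensity

variable {a b : ℝ} {φ : ℝ → ℝ}

theorem intervalIntegrable_sub (h : IsInvertibleDensity a b φ) (hab : a ≤ b) {x y : ℝ}
    (hx : x ∈ Set.Icc a b) (hy : y ∈ Set.Icc a b) :
    IntervalIntegrable φ MeasureTheory.volume x y :=
  h.integrable.mono_set (by
    rw [Set.uIcc_of_le hab]
    exact Set.uIcc_subset_Icc hx hy)

theorem cdfOn_sub (h : IsInvertibleDensity a b φ) (hab : a ≤ b) {x y : ℝ}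
    (hx : x ∈ Set.Icc a b) (hy : y ∈ Set.Icc a b) :
    cdfOn a φ y - cdfOn a φ x = ∫ t in x..y, φ t :=
  intervalIntegral.integral_interval_sub_left
    (h.intervalIntegrable_sub hab (Set.left_mem_Icc.2 hab) hy)
    (h.intervalIntegrable_sub hab (Set.left_mem_Icc.2 hab) hx)

theorem monotoneOn_cdfOn (h : IsInvertibleDensity a b φ) (hab : a ≤ b) :
    MonotoneOn (cdfOn a φ) (Set.Icc a b) := by
  intro x hx y hy hxy
  rw [← sub_nonneg, h.cdfOn_sub hab hx hy]
  exact intervalIntegral.integral_nonneg hxy fun t ht => h.nonneg t ⟨hx.1.trans ht.1, ht.2.trans hy.2⟩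

theorem invCdfOn_mem (h : IsInvertibleDensity a b φ) {y : ℝ} (hy : y ∈ Set.Icc (0 : ℝ) 1) :
    invCdfOn a b φ y ∈ Set.Icc a b :=
  Function.invFunOn_mem (h.bijOn.surjOn hy)

theorem cdfOn_invCdfOn (h : IsInvertibleDensity a b φ) {y : ℝ} (hy : y ∈ Set.Icc (0 : ℝ) 1) :
    cdfOn a φ (invCdfOn a b φ y) = y :=
  Function.invFunOn_eq (h.bijOn.surjOn hy)

theorem monotoneOn_invCdfOn (h : IsInvertibleDensity a b φ) (hab : a ≤ b) :
    MonotoneOn (invCdfOn a b φ) (Set.Icc 0 1) := by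
  intro y hy y' hy' hyy
  by_contra! hlt
  have := h.monotoneOn_cdfOn hab (h.invCdfOn_mem hy') (h.invCdfOn_mem hy) hlt.le
  rw [h.cdfOn_invCdfOn hy, h.cdfOn_invCdfOn hy'] at this
  rw [le_antisymm hyy this] at hlt
  exact lt_irrefl _ hlt

theorem invCdfOn_zero (h : IsInvertibleDensity a b φ) (hab : a ≤ b) : invCdfOn a b φ 0 = a := by
  refine h.bijOn.injOn (h.invCdfOn_mem (by simp)) (Set.left_mem_Icc.2 hab) ?_
  rw [h.cdfOn_invCdfOn (by simp), cdfOn, intervalIntegral.integral_same]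

theorem invCdfOn_one (h : IsInvertibleDensity a b φ) (hab : a ≤ b) : invCdfOn a b φ 1 = b := by
  refine h.bijOn.injOn (h.invCdfOn_mem (by simp)) (Set.right_mem_Icc.2 hab) ?_
  rw [h.cdfOn_invCdfOn (by simp), cdfOn, h.integral_eq_one]

end IsInvertibleDensity

/-- The quantiles `Φ⁻¹(c / M)`. -/
noncomputable def quantile (a b : ℝ) (φ : ℝ → ℝ) (M c : ℕ) : ℝ := invCdfOn a b φ (min (c / M) 1)

theorem quantile_eq (a b : ℝ) (φ : ℝ → ℝ) {M c : ℕ} (hc : c ≤ M) :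
    quantile a b φ M c = invCdfOn a b φ (c / M) := by
  rw [quantile, min_eq_left]
  exact div_le_one_of_le₀ (by exact_mod_cast hc) (Nat.cast_nonneg _)

namespace IsInvertibleDensity

variable {a b : ℝ} {φ : ℝ → ℝ} {M : ℕ}

theorem min_div_mem (M c : ℕ) : min ((c : ℝ) / M) 1 ∈ Set.Icc (0 : ℝ) 1 :=
  ⟨le_min (by positivity) zero_le_one, min_le_right _ _⟩

/-- The truncation in `quantile` keeps arguments in `[0, 1]`, so monotonicity holds on all of `ℕ`,
as required for partitioning the interval into consecutive cells. -/
theorem monotone_quantile (h : IsInvertibleDensity a b φ) (hab : a ≤ b) :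
    Monotone (quantile a b φ M) := by
  intro c c' hcc
  refine h.monotoneOn_invCdfOn hab (min_div_mem _ _) (min_div_mem _ _) ?_
  gcongr

theorem quantile_mem (h : IsInvertibleDensity a b φ) (c : ℕ) :
    quantile a b φ M c ∈ Set.Icc a b := h.invCdfOn_mem (min_div_mem _ _)

theorem quantile_zero (h : IsInvertibleDensity a b φ) (hab : a ≤ b) :
    quantile a b φ M 0 = a := by
  rw [quantile_eq _ _ _ (Nat.zero_le _), Nat.cast_zero, zero_div, h.invCdfOn_zero hab]

theorem quantile_self (h : IsInvertibleDensity a b φ) (hab : a ≤ b) (hM : 0 < M) :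
    quantile a b φ M M = b := by
  rw [quantile_eq _ _ _ le_rfl, div_self (by exact_mod_cast hM.ne'), h.invCdfOn_one hab]

theorem setIntegral_quantile (h : IsInvertibleDensity a b φ) (hab : a ≤ b) {c : ℕ} (hc : c < M) :
    ∫ x in Set.Ioc (quantile a b φ M c) (quantile a b φ M (c + 1)), φ x = 1 / M := by
  have hM : (M : ℝ) ≠ 0 := by exact_mod_cast (Nat.zero_le _).trans_lt hc |>.ne'
  rw [← intervalIntegral.integral_of_le (h.monotone_quantile hab (Nat.le_succ c)),
    ← h.cdfOn_sub hab (h.quantile_mem _) (h.quantile_mem _), quantile, quantile,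
    h.cdfOn_invCdfOn (min_div_mem _ _), h.cdfOn_invCdfOn (min_div_mem _ _), min_eq_left,
    min_eq_left]
  · push_cast
    field_simp
    ring
  · exact div_le_one_of_le₀ (by exact_mod_cast hc.le) (Nat.cast_nonneg _)
  · exact div_le_one_of_le₀ (by exact_mod_cast hc) (Nat.cast_nonneg _)

theorem sum_quantile_sub (h : IsInvertibleDensity a b φ) (hab : a ≤ b) (hM : 0 < M) :
    ∑ c ∈ Finset.range M, (quantile a b φ M (c + 1) - quantile a b φ M c) = b - a := by
  rw [Finset.sum_range_sub, h.quantile_zero hab, h.quantile_self hab hM]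

theorem invCdfOn_mem_Icc_quantile (h : IsInvertibleDensity a b φ) (hab : a ≤ b) {c : ℕ}
    (hc : c < M) {y : ℝ} (hy : y ∈ Set.Icc ((c : ℝ) / M) ((c + 1 : ℕ) / M)) :
    invCdfOn a b φ y ∈ Set.Icc (quantile a b φ M c) (quantile a b φ M (c + 1)) := by
  have h1 : ((c + 1 : ℕ) : ℝ) / M ≤ 1 :=
    div_le_one_of_le₀ (by exact_mod_cast hc) (Nat.cast_nonneg _)
  have h0 : (0 : ℝ) ≤ c / M := by positivity
  rw [quantile_eq _ _ _ hc.le, quantile_eq _ _ _ hc]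
  exact ⟨h.monotoneOn_invCdfOn hab ⟨h0, hy.1.trans (hy.2.trans h1)⟩
      ⟨h0.trans hy.1, hy.2.trans h1⟩ hy.1,
    h.monotoneOn_invCdfOn hab ⟨h0.trans hy.1, hy.2.trans h1⟩
      ⟨h0.trans (hy.1.trans hy.2), h1⟩ hy.2⟩

end IsInvertibleDensity

/-! ### Approximation of the integral by averages over grids -/

theorem sum_piFinset_apply {s M : ℕ} (hM : 0 < M) (i : Fin s) (f : ℕ → ℝ) :
    ∑ c ∈ Fintype.piFinset fun _ : Fin s => Finset.range M, (1 / (M : ℝ)) ^ s * f (c i) =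
      1 / M * ∑ j ∈ Finset.range M, f j := by
  have hM' : (M : ℝ) ≠ 0 := by exact_mod_cast hM.ne'
  have h := Finset.prod_univ_sum (fun _ : Fin s => Finset.range M)
    (fun i' j => 1 / (M : ℝ) * if i' = i then f j else 1)
  rw [← Finset.mul_prod_erase _ _ (Finset.mem_univ i), Finset.prod_eq_one (s := Finset.univ.erase i),
    mul_one] at h
  · simp only [if_true, ← Finset.mul_sum] at h
    rw [h]
    refine Finset.sum_congr rfl fun c _ => ?_
    rw [Finset.prod_mul_distrib, Finset.prod_ite_eq' Finset.univ i fun i' => f (c i')]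
    simp
  · intro j hj
    simp [Finset.ne_of_mem_erase hj, hM']

theorem integrableOn_prod_density {s : ℕ} {a b : Fin s → ℝ} (hab : ∀ i, a i ≤ b i)
    {φ : Fin s → ℝ → ℝ} (hφ : ∀ i, IsInvertibleDensity (a i) (b i) (φ i)) :
    MeasureTheory.IntegrableOn (fun x => ∏ i, φ i (x i)) (Set.Icc a b) := by
  rw [← Set.pi_univ_Icc, MeasureTheory.IntegrableOn, MeasureTheory.volume_pi,
    MeasureTheory.Measure.restrict_pi_pi]
  refine MeasureTheory.Integrable.fintype_prod fun i => ?_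
  exact (intervalIntegrable_iff_integrableOn_Icc_of_le (hab i)).1 (hφ i).integrable

/-- Each quantile box has mass `(1 / M) ^ s`, so the error on a box is at most its mass times the
Lipschitz oscillation. Averaged over all boxes, the side length in direction `i` telescopes to `(b i
- a i) / M`. -/
theorem abs_sum_sub_integral_le {s M : ℕ} (hM : 0 < M) {a b : Fin s → ℝ} (hab : ∀ i, a i ≤ b i)
    {φ : Fin s → ℝ → ℝ} (hφ : ∀ i, IsInvertibleDensity (a i) (b i) (φ i))
    {F : (Fin s → ℝ) → ℝ} (hF : ContinuousOn F (Set.Icc a b)) {ℓ : Fin s → ℝ} (hℓ : ∀ i, 0 ≤ ℓ i)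
    (hlip : ∀ x ∈ Set.Icc a b, ∀ y ∈ Set.Icc a b, |F x - F y| ≤ ∑ i, ℓ i * |x i - y i|)
    {z : Fin s → ℕ → ℝ} (hz : ∀ i, ∀ c < M, z i c ∈
      Set.Icc (quantile (a i) (b i) (φ i) M c) (quantile (a i) (b i) (φ i) M (c + 1))) :
    M * |(∑ c ∈ Fintype.piFinset fun _ : Fin s => Finset.range M,
        (1 / (M : ℝ)) ^ s * F fun i => z i (c i)) - ∫ x in Set.Icc a b, F x * ∏ i, φ i (x i)|
      ≤ ∑ i, ℓ i * (b i - a i) := by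
  have hM' : (M : ℝ) ≠ 0 := by exact_mod_cast hM.ne'
  set ξ : Fin s → ℕ → ℝ := fun i => quantile (a i) (b i) (φ i) M with hξ
  set S := Fintype.piFinset fun _ : Fin s => Finset.range M with hS
  have hξm : ∀ i, Monotone (ξ i) := fun i => (hφ i).monotone_quantile (hab i)
  have hξI : ∀ i c, ξ i c ∈ Set.Icc (a i) (b i) := fun i c => (hφ i).quantile_mem c
  set cell : (Fin s → ℕ) → Set (Fin s → ℝ) := fun c =>
    Set.univ.pi fun i => Set.Ioc (ξ i (c i)) (ξ i (c i + 1)) with hcell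
  have hcellsub : ∀ c, cell c ⊆ Set.Icc a b := by
    intro c x hx
    exact ⟨fun i => (hξI i _).1.trans (hx i trivial).1.le,
      fun i => (hx i trivial).2.trans (hξI i _).2⟩
  have hcellmeas : ∀ c, MeasurableSet (cell c) := fun c =>
    MeasurableSet.univ_pi fun i => measurableSet_Ioc
  have hSlt : ∀ {c}, c ∈ S → ∀ i, c i < M := fun hc i =>
    Finset.mem_range.1 (Fintype.mem_piFinset.1 hc i)
  have hunion : (⋃ c ∈ S, cell c) = Set.univ.pi fun i => Set.Ioc (a i) (b i) := by
    have h1 : ∀ i, (⋃ j ∈ Set.Ico 0 M, Set.Ioc (ξ i j) (ξ i (j + 1))) = Set.Ioc (a i) (b i) := by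
      intro i
      have := (hξm i).biUnion_Ico_Ioc_map_succ 0 M
      simp only [Order.succ_eq_add_one] at this
      rw [this, hξ]
      simp only [(hφ i).quantile_zero (hab i), (hφ i).quantile_self (hab i) hM]
    ext x
    simp only [Set.mem_iUnion, hcell, Set.mem_univ_pi, ← h1, exists_prop, Set.mem_Ico, zero_le,
      true_and]
    constructor
    · rintro ⟨c, hc, hx⟩ i
      exact ⟨c i, hSlt hc i, hx i⟩
    · intro h
      choose c hc using h
      exact ⟨c, Fintype.mem_piFinset.2 fun i => Finset.mem_range.2 (hc i).1, fun i => (hc i).2⟩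
  have hdisj : (S : Set (Fin s → ℕ)).Pairwise (Function.onFun Disjoint cell) := by
    intro c _ c' _ hne
    obtain ⟨i, hi⟩ := Function.ne_iff.1 hne
    refine Set.disjoint_left.2 fun x hx hx' => ?_
    have := (hξm i).pairwise_disjoint_on_Ioc_succ hi
    exact Set.disjoint_left.1 this (hx i trivial) (hx' i trivial)
  have hφint := integrableOn_prod_density hab hφ
  have hFφ : MeasureTheory.IntegrableOn (fun x => F x * ∏ i, φ i (x i)) (Set.Icc a b) :=
    hφint.continuousOn_mul hF isCompact_Icc
  have hcellφ : ∀ c ∈ S, ∫ x in cell c, ∏ i, φ i (x i) = (1 / (M : ℝ)) ^ s := by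
    intro c hc
    rw [hcell, MeasureTheory.volume_pi, MeasureTheory.Measure.restrict_pi_pi,
      MeasureTheory.integral_fintype_prod_eq_prod,
      Finset.prod_congr rfl fun i _ => (hφ i).setIntegral_quantile (hab i) (hSlt hc i)]
    simp
  have hint : ∫ x in Set.Icc a b, F x * ∏ i, φ i (x i) =
      ∑ c ∈ S, ∫ x in cell c, F x * ∏ i, φ i (x i) := by
    have hae : (Set.univ.pi fun i => Set.Ioc (a i) (b i)) =ᵐ[MeasureTheory.volume] Set.Icc a b :=
      MeasureTheory.Measure.univ_pi_Ioc_ae_eq_Icc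
    rw [← MeasureTheory.setIntegral_congr_set hae, ← hunion]
    exact MeasureTheory.integral_biUnion_finset S (fun c _ => hcellmeas c) hdisj
      fun c _ => hFφ.mono_set (hcellsub c)
  have hzbox : ∀ c ∈ S, (fun i => z i (c i)) ∈ Set.Icc a b := fun c hc =>
    ⟨fun i => (hξI i _).1.trans (hz i _ (hSlt hc i)).1,
      fun i => (hz i _ (hSlt hc i)).2.trans (hξI i _).2⟩
  have hterm : ∀ c ∈ S, |(1 / (M : ℝ)) ^ s * F (fun i => z i (c i)) -
      ∫ x in cell c, F x * ∏ i, φ i (x i)| ≤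
      (1 / (M : ℝ)) ^ s * ∑ i, ℓ i * (ξ i (c i + 1) - ξ i (c i)) := by
    intro c hc
    -- The weight is rewritten as the mass of the cell, so that both terms become integrals over it.
    rw [← hcellφ c hc, ← MeasureTheory.integral_mul_const, ← MeasureTheory.integral_mul_const,
      abs_sub_comm, ← MeasureTheory.integral_sub (hFφ.mono_set (hcellsub c))
        ((hφint.mono_set (hcellsub c)).mul_const _), ← Real.norm_eq_abs]
    refine MeasureTheory.norm_integral_le_of_norm_le
      ((hφint.mono_set (hcellsub c)).mul_const _) ?_
    refine MeasureTheory.ae_restrict_of_forall_mem (hcellmeas c) fun x hx => ?_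
    have hxI := hcellsub c hx
    have hnn : 0 ≤ ∏ i, φ i (x i) :=
      Finset.prod_nonneg fun i _ => (hφ i).nonneg _ ⟨hxI.1 i, hxI.2 i⟩
    have : F x * ∏ i, φ i (x i) - (∏ i, φ i (x i)) * F (fun i => z i (c i)) =
      (∏ i, φ i (x i)) * (F x - F fun i => z i (c i)) := by ring
    rw [this, Real.norm_eq_abs, abs_mul, abs_of_nonneg hnn]
    refine mul_le_mul_of_nonneg_left ((hlip x hxI _ (hzbox c hc)).trans ?_) hnn
    refine Finset.sum_le_sum fun i _ => mul_le_mul_of_nonneg_left ?_ (hℓ i)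
    have h1 := hx i trivial
    have h2 := hz i _ (hSlt hc i)
    rw [abs_le]
    constructor <;> linarith [h1.1, h1.2, h2.1, h2.2]
  rw [hint, ← Finset.sum_sub_distrib]
  calc (M : ℝ) * |∑ c ∈ S, ((1 / (M : ℝ)) ^ s * F (fun i => z i (c i)) -
          ∫ x in cell c, F x * ∏ i, φ i (x i))|
      ≤ M * ∑ c ∈ S, (1 / (M : ℝ)) ^ s * ∑ i, ℓ i * (ξ i (c i + 1) - ξ i (c i)) := by
        gcongr
        exact (Finset.abs_sum_le_sum_abs _ _).trans (Finset.sum_le_sum hterm)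
    _ = M * ∑ i, ∑ c ∈ S, (1 / (M : ℝ)) ^ s * (ℓ i * (ξ i (c i + 1) - ξ i (c i))) := by
        simp_rw [Finset.mul_sum]
        rw [Finset.sum_comm]
    _ = ∑ i, ℓ i * (b i - a i) := by
        rw [Finset.mul_sum]
        refine Finset.sum_congr rfl fun i _ => ?_
        rw [sum_piFinset_apply hM i fun j => ℓ i * (ξ i (j + 1) - ξ i j), ← Finset.mul_sum,
          (hφ i).sum_quantile_sub (hab i) hM]
        field_simp

/-! ### Points of a block of a digital sequence -/

theorem summable_digits (y : ℕ → ZMod 2) : Summable fun k : ℕ => ((y k).val : ℝ) / 2 ^ (k + 1) := by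
  refine Summable.of_nonneg_of_le (fun k => by positivity) (fun k => ?_)
    (summable_geometric_two' 1)
  have : ((y k).val : ℝ) ≤ 1 := by exact_mod_cast Nat.le_of_lt_succ (zmod_two_val_lt (y k))
  rw [div_div, ← pow_succ']
  gcongr

theorem tsum_digits_mem (y : ℕ → ZMod 2) (m : ℕ) :
    ∑' k : ℕ, ((y (k + m)).val : ℝ) / 2 ^ (k + m + 1) ∈ Set.Icc (0 : ℝ) (1 / 2 ^ m) := by
  refine ⟨tsum_nonneg fun k => by positivity, ?_⟩
  rw [← tsum_geometric_two' (1 / 2 ^ m : ℝ)]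
  refine Summable.tsum_le_tsum (fun k => ?_) ((summable_nat_add_iff m).2 (summable_digits y))
    (summable_geometric_two' _)
  have : ((y (k + m)).val : ℝ) ≤ 1 := by
    exact_mod_cast Nat.le_of_lt_succ (zmod_two_val_lt (y (k + m)))
  rw [div_div, div_div, show k + m + 1 = m + (k + 1) by ring, pow_add _ m, pow_succ']
  gcongr

theorem digitalPoint_eq {s : ℕ} (C : Fin s → Matrix ℕ ℕ (ZMod 2)) (n m : ℕ) (i : Fin s) :
    digitalPoint C n i = prefixNum (outputDigit (C i) n) m / 2 ^ m +
      ∑' k : ℕ, ((outputDigit (C i) n (k + m)).val : ℝ) / 2 ^ (k + m + 1) := by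
  rw [prefixNum_cast_div, digitalPoint]
  exact ((summable_digits (outputDigit (C i) n)).sum_add_tsum_nat_add m).symm

/-- The common distance of the points of the `q`-th block of length `2 ^ m` to the left end points
of the cells of level `m` that contain them. -/
noncomputable def blockOffset {s : ℕ} (C : Fin s → Matrix ℕ ℕ (ZMod 2)) (m q : ℕ) (i : Fin s) : ℝ :=
  ∑' k : ℕ, ((outputDigit (C i) (2 ^ m * q) (k + m)).val : ℝ) / 2 ^ (k + m + 1)

theorem blockOffset_mem {s : ℕ} (C : Fin s → Matrix ℕ ℕ (ZMod 2)) (m q : ℕ) (i : Fin s) :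
    blockOffset C m q i ∈ Set.Icc (0 : ℝ) (1 / 2 ^ m) := tsum_digits_mem _ m

/-- Triangularity enters here: digits of `r < 2 ^ m` do not reach the rows from `m` on, so the tail
depends on `q` alone. -/
theorem digitalPoint_block {s : ℕ} {C : Fin s → Matrix ℕ ℕ (ZMod 2)}
    (hC : ∀ i k l, l < k → C i k l = 0) {m r : ℕ} (q : ℕ) (hr : r < 2 ^ m) (i : Fin s) :
    digitalPoint C (2 ^ m * q + r) i = cellIndex C m q r i / 2 ^ m + blockOffset C m q i := by
  rw [digitalPoint_eq C _ m, cellIndex, blockOffset]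
  congr 2
  ext k
  rw [outputDigit_add _ _ hr, outputDigit_eq_zero (hC i) hr (Nat.le_add_left m k), add_zero]

theorem add_offset_mem {m d c : ℕ} (hd : d ≤ m) {ρ : ℝ} (hρ : ρ ∈ Set.Icc (0 : ℝ) (1 / 2 ^ m)) :
    (c : ℝ) / 2 ^ m + ρ ∈ Set.Icc (((c / 2 ^ (m - d) : ℕ) : ℝ) / (2 ^ d : ℕ))
      (((c / 2 ^ (m - d) + 1 : ℕ) : ℝ) / (2 ^ d : ℕ)) := by
  have hpow : (2 : ℝ) ^ m = 2 ^ (m - d) * 2 ^ d := by rw [← pow_add, Nat.sub_add_cancel hd]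
  have h1 : ((c / 2 ^ (m - d) : ℕ) : ℝ) * 2 ^ (m - d) ≤ c := by
    exact_mod_cast Nat.div_mul_le_self c _
  have h2 : (c : ℝ) + 1 ≤ ((c / 2 ^ (m - d) + 1 : ℕ) : ℝ) * 2 ^ (m - d) := by
    have := Nat.lt_div_mul_add (a := c) (b := 2 ^ (m - d)) (by positivity)
    have h : c + 1 ≤ (c / 2 ^ (m - d) + 1) * 2 ^ (m - d) := by rw [add_mul]; omega
    exact_mod_cast h
  rw [Nat.cast_pow, Nat.cast_ofNat]
  constructor
  · have : ((c / 2 ^ (m - d) : ℕ) : ℝ) / 2 ^ d ≤ c / 2 ^ m := by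
      rw [div_le_div_iff₀ (by positivity) (by positivity), hpow, ← mul_assoc]
      gcongr
    linarith [hρ.1]
  · have : ((c : ℝ) + 1) / 2 ^ m ≤ ((c / 2 ^ (m - d) + 1 : ℕ) : ℝ) / 2 ^ d := by
      rw [div_le_div_iff₀ (by positivity) (by positivity), hpow, ← mul_assoc]
      gcongr
    rw [add_div] at this
    linarith [hρ.2]

/-! ### Mixed differences summed over a block -/

/-- Every vertex `κ ≤ k` has total level at most `m - t`, where the block is exactly
equidistributed. All vertices thus give the same sum, and the signs over subsets of a nonempty set
cancel. -/
theorem sum_sum_levelDiff_eq_zero {s t m : ℕ} {C : Fin s → Matrix ℕ ℕ (ZMod 2)} (q : ℕ)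
    {k : Fin s → ℕ} (hu : (levelSupport k).Nonempty)
    (hC : GeneratesDigitalNet t m fun i : levelSupport k => upperLeft m (C i))
    (hk : ∑ i, k i ≤ m - t) (g : (Fin s → ℕ) → ℝ) :
    ∑ r ∈ Finset.range (2 ^ m), ∑ v ∈ Fintype.piFinset fun _ : Fin s => Finset.range (2 ^ m),
      levelDiff k (fun κ => g fun i => mixDigits m (κ i) (cellIndex C m q r i) (v i)) = 0 := by
  set V := Fintype.piFinset fun _ : Fin s => Finset.range (2 ^ m) with hV
  have hterm : ∀ e ∈ (levelSupport k).powerset, ∑ r ∈ Finset.range (2 ^ m), ∑ v ∈ V,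
      g (fun i => mixDigits m (e.piecewise (fun i => k i - 1) k i) (cellIndex C m q r i) (v i)) =
      2 ^ m * ∑ v ∈ V, g v := by
    intro e _
    set κ := e.piecewise (fun i => k i - 1) k with hκ
    have hκk : ∀ i, κ i ≤ k i := by
      intro i
      by_cases hi : i ∈ e <;> simp [hκ, hi]
    have hsum : ∑ i, κ i ≤ m - t := (Finset.sum_le_sum fun i _ => hκk i).trans hk
    have hκm : ∀ i, κ i ≤ m := fun i =>
      ((Finset.single_le_sum (fun j _ => Nat.zero_le (κ j)) (Finset.mem_univ i)).trans
        hsum).trans (Nat.sub_le _ _)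
    rw [sum_sum_mixDigits (K := 2 ^ (m - ∑ i, κ i)) hκm (fun r _ i => cellIndex_lt C m q r i) ?_ g]
    · rw [Nat.cast_pow, Nat.cast_ofNat, ← pow_add,
        Nat.sub_add_cancel (hsum.trans (Nat.sub_le _ _))]
    · intro c hc
      refine card_cellIndex_eq q hu hC (fun i hi => ?_) hsum fun i =>
        Finset.mem_range.1 (Fintype.mem_piFinset.1 hc i)
      rw [mem_levelSupport, not_not] at hi
      exact Nat.le_zero.1 (hi ▸ hκk i)
  have hswap : ∑ r ∈ Finset.range (2 ^ m), ∑ v ∈ V,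
      levelDiff k (fun κ => g fun i => mixDigits m (κ i) (cellIndex C m q r i) (v i)) =
      ∑ e ∈ (levelSupport k).powerset, (-1) ^ e.card * ∑ r ∈ Finset.range (2 ^ m), ∑ v ∈ V,
        g (fun i => mixDigits m (e.piecewise (fun i => k i - 1) k i)
          (cellIndex C m q r i) (v i)) := by
    simp_rw [levelDiff, Finset.mul_sum]
    rw [Finset.sum_comm (s := (levelSupport k).powerset)]
    exact Finset.sum_congr rfl fun r _ => Finset.sum_comm
  rw [hswap, Finset.sum_congr rfl fun e he => by rw [hterm e he], ← Finset.sum_mul]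
  have := Finset.sum_powerset_neg_one_pow_card_of_nonempty hu
  have h0 : ∑ e ∈ (levelSupport k).powerset, (-1 : ℝ) ^ e.card = 0 := by exact_mod_cast this
  rw [h0, zero_mul]

/-! ### Grid nodes and cells transported by the inverse distribution functions -/

section Block

variable {s : ℕ} {a b : Fin s → ℝ} {φ : Fin s → ℝ → ℝ} {F : (Fin s → ℝ) → ℝ}
  {L : Finset (Fin s) → ℝ} {C : Fin s → Matrix ℕ ℕ (ZMod 2)}

/-- The image under the inverse distribution function of the point with cell index `c` and offset
`ρ`. -/
noncomputable def gridNode (a b : Fin s → ℝ) (φ : Fin s → ℝ → ℝ) (m : ℕ) (ρ : Fin s → ℝ)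
    (i : Fin s) (c : ℕ) : ℝ :=
  invCdfOn (a i) (b i) (φ i) (c / 2 ^ m + ρ i)

theorem gridNode_mem (hab : ∀ i, a i ≤ b i) (hφ : ∀ i, IsInvertibleDensity (a i) (b i) (φ i))
    {m d c : ℕ} (hd : d ≤ m) {ρ : Fin s → ℝ} (hρ : ∀ i, ρ i ∈ Set.Icc (0 : ℝ) (1 / 2 ^ m))
    (hc : c < 2 ^ m) (i : Fin s) :
    gridNode a b φ m ρ i c ∈ Set.Icc (quantile (a i) (b i) (φ i) (2 ^ d) (c / 2 ^ (m - d)))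
      (quantile (a i) (b i) (φ i) (2 ^ d) (c / 2 ^ (m - d) + 1)) := by
  refine (hφ i).invCdfOn_mem_Icc_quantile (hab i) ?_ (add_offset_mem hd (hρ i))
  refine Nat.div_lt_of_lt_mul ?_
  rwa [← pow_add, Nat.sub_add_cancel hd]

theorem gridNode_mem_Icc (hab : ∀ i, a i ≤ b i)
    (hφ : ∀ i, IsInvertibleDensity (a i) (b i) (φ i))
    {m : ℕ} {ρ : Fin s → ℝ} (hρ : ∀ i, ρ i ∈ Set.Icc (0 : ℝ) (1 / 2 ^ m)) {c : Fin s → ℕ}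
    (hc : ∀ i, c i < 2 ^ m) : (fun i => gridNode a b φ m ρ i (c i)) ∈ Set.Icc a b :=
  ⟨fun i => ((hφ i).quantile_mem _).1.trans (gridNode_mem hab hφ le_rfl hρ (hc i) i).1,
    fun i => (gridNode_mem hab hφ le_rfl hρ (hc i) i).2.trans ((hφ i).quantile_mem _).2⟩

/-- The length of the image of the `c`-th cell of level `d`. -/
noncomputable def cellLength (a b : Fin s → ℝ) (φ : Fin s → ℝ → ℝ) (i : Fin s) (d c : ℕ) : ℝ :=
  quantile (a i) (b i) (φ i) (2 ^ d) (c + 1) - quantile (a i) (b i) (φ i) (2 ^ d) c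

theorem cellLength_nonneg (hab : ∀ i, a i ≤ b i)
    (hφ : ∀ i, IsInvertibleDensity (a i) (b i) (φ i)) (i : Fin s) (d c : ℕ) :
    0 ≤ cellLength a b φ i d c :=
  sub_nonneg.2 ((hφ i).monotone_quantile (hab i) (Nat.le_succ c))

/-- The two corners use `k i` and `k i - 1` digits of `w i`. They agree with `w i` in the first `k i
- 1` digits, so both lie in one cell of level `k i - 1`. -/
theorem abs_levelDiff_le (hab : ∀ i, a i ≤ b i)
    (hφ : ∀ i, IsInvertibleDensity (a i) (b i) (φ i)) (hF : HasMixedPartials a b F)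
    (hL : ∀ u, ∀ x ∈ Set.Icc a b, |mixedPartial a b u F x| ≤ L u) (hL0 : ∀ u, 0 ≤ L u)
    {m : ℕ} {ρ : Fin s → ℝ} (hρ : ∀ i, ρ i ∈ Set.Icc (0 : ℝ) (1 / 2 ^ m))
    {k w v : Fin s → ℕ} (hk : ∀ i, k i ≤ m) (hw : ∀ i, w i < 2 ^ m) :
    |levelDiff k (fun κ => F fun i => gridNode a b φ m ρ i (mixDigits m (κ i) (w i) (v i)))| ≤
      L (levelSupport k) * ∏ i ∈ levelSupport k,
        cellLength a b φ i (k i - 1) (w i / 2 ^ (m - (k i - 1))) := by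
  set α : Fin s → ℝ := fun i => gridNode a b φ m ρ i (mixDigits m (k i) (w i) (v i)) with hα
  set β : Fin s → ℝ := fun i => gridNode a b φ m ρ i (mixDigits m (k i - 1) (w i) (v i)) with hβ
  have hk1 : ∀ i, k i - 1 ≤ m := fun i => (Nat.sub_le _ _).trans (hk i)
  have h1 : levelDiff k
      (fun κ => F fun i => gridNode a b φ m ρ i (mixDigits m (κ i) (w i) (v i))) =
      boxDiff (levelSupport k) F α β := by
    refine Finset.sum_congr rfl fun e _ => ?_
    refine congrArg (fun y => (-1 : ℝ) ^ e.card * F y) ?_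
    ext i
    by_cases hi : i ∈ e <;> simp [hi, hα, hβ]
  rw [h1]
  refine (hF.abs_boxDiff_le (hL _)
    (gridNode_mem_Icc hab hφ hρ fun i => mixDigits_lt (hk i) (hw i))
    (gridNode_mem_Icc hab hφ hρ fun i => mixDigits_lt (hk1 i) (hw i))).trans ?_
  refine mul_le_mul_of_nonneg_left ?_ (hL0 _)
  refine Finset.prod_le_prod (fun i _ => abs_nonneg _) fun i _ => ?_
  have hA := gridNode_mem hab hφ (hk1 i) hρ (mixDigits_lt (v := v i) (hk i) (hw i)) i
  have hB := gridNode_mem hab hφ (hk1 i) hρ (mixDigits_lt (v := v i) (hk1 i) (hw i)) i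
  rw [mixDigits_div (Nat.sub_le _ _) (hk i)] at hA
  rw [mixDigits_div le_rfl (hk1 i)] at hB
  rw [cellLength, abs_le]
  constructor <;> linarith [hA.1, hA.2, hB.1, hB.2]

/-- The points are grouped by their cell of level `k - 1`; the occupancy bound applies to each cell,
and the remaining sum of side products factors and telescopes. -/
theorem sum_prod_cellLength_le (hab : ∀ i, a i ≤ b i)
    (hφ : ∀ i, IsInvertibleDensity (a i) (b i) (φ i)) {t m : ℕ} (q : ℕ)
    {k : Fin s → ℕ} (hk : ∀ i, k i ≤ m) (hu : (levelSupport k).Nonempty)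
    (hC : t ≤ m → GeneratesDigitalNet t m fun i : levelSupport k => upperLeft m (C i))
    (hsum : m ≤ t + ∑ i, k i) :
    ∑ r ∈ Finset.range (2 ^ m), ∏ i ∈ levelSupport k,
        cellLength a b φ i (k i - 1) (cellIndex C m q r i / 2 ^ (m - (k i - 1))) ≤
      2 ^ (t + (levelSupport k).card) * ∏ i ∈ levelSupport k, (b i - a i) := by
  set u := levelSupport k with hu'
  have hk1 : ∀ i, k i - 1 ≤ m := fun i => (Nat.sub_le _ _).trans (hk i)
  set D := Fintype.piFinset fun i => Finset.range (2 ^ (k i - 1)) with hD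
  have hk0 : ∀ i, i ∉ u → k i = 0 := fun i hi => by
    rwa [hu', mem_levelSupport, not_not] at hi
  -- Lowering every nonzero level by one loses `u.card` in total, exactly the slack allowed in
  -- `card_cellIndex_le`.
  have hsum' : ∑ i, (k i - 1) + u.card = ∑ i, k i := by
    have h1 : u.card = ∑ i, if i ∈ u then 1 else 0 := by simp
    rw [h1, ← Finset.sum_add_distrib]
    refine Finset.sum_congr rfl fun i _ => ?_
    by_cases hi : i ∈ u
    · have := mem_levelSupport.1 hi
      simp only [hi, if_true]
      omega
    · simp [hi, hk0 i hi]
  have hmaps : ∀ r ∈ Finset.range (2 ^ m),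
      (fun i => cellIndex C m q r i / 2 ^ (m - (k i - 1))) ∈ D := by
    intro r _
    rw [hD, Fintype.mem_piFinset]
    intro i
    rw [Finset.mem_range]
    refine Nat.div_lt_of_lt_mul ?_
    rw [← pow_add, Nat.sub_add_cancel (hk1 i)]
    exact cellIndex_lt C m q r i
  calc _ = ∑ c ∈ D, ∑ r ∈ Finset.range (2 ^ m) with
          (fun i => cellIndex C m q r i / 2 ^ (m - (k i - 1))) = c,
          ∏ i ∈ u, cellLength a b φ i (k i - 1) (c i) := by
        rw [← Finset.sum_fiberwise_of_maps_to hmaps]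
        refine Finset.sum_congr rfl fun c _ => Finset.sum_congr rfl fun r hr => ?_
        rw [← (Finset.mem_filter.1 hr).2]
    _ ≤ ∑ c ∈ D, 2 ^ (t + u.card) * ∏ i ∈ u, cellLength a b φ i (k i - 1) (c i) := by
        refine Finset.sum_le_sum fun c hc => ?_
        rw [Finset.sum_const, nsmul_eq_mul]
        refine mul_le_mul_of_nonneg_right ?_
          (Finset.prod_nonneg fun i _ => cellLength_nonneg hab hφ _ _ _)
        have := card_cellIndex_le (t := t) q hu hC (d := fun i => k i - 1)
          (fun i hi => by simp only [hk0 i hi]) hk1 (by rw [hsum']; exact hsum)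
          fun i => Finset.mem_range.1 (Fintype.mem_piFinset.1 hc i)
        exact_mod_cast this
    _ = 2 ^ (t + u.card) * ∏ i ∈ u, (b i - a i) := by
        rw [← Finset.mul_sum]
        congr 1
        have h := Finset.prod_univ_sum (fun i => Finset.range (2 ^ (k i - 1)))
          (fun i c => if i ∈ u then cellLength a b φ i (k i - 1) c else 1)
        have h2 : ∀ c : Fin s → ℕ, ∏ i, (if i ∈ u then cellLength a b φ i (k i - 1) (c i) else 1) =
            ∏ i ∈ u, cellLength a b φ i (k i - 1) (c i) := fun c => by
          rw [Finset.prod_ite_mem, Finset.univ_inter]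
        simp_rw [h2] at h
        rw [hD, ← h]
        have h3 : ∏ i ∈ u, (b i - a i) = ∏ i, if i ∈ u then b i - a i else 1 := by
          rw [Finset.prod_ite_mem, Finset.univ_inter]
        rw [h3]
        refine Finset.prod_congr rfl fun i _ => ?_
        by_cases hi : i ∈ u
        · simp only [hi, if_true, cellLength]
          exact (hφ i).sum_quantile_sub (hab i) (by positivity)
        · simp [hi, hk0 i hi]

end Block

/-! ### The error on a block -/

section Block

variable {s : ℕ} {a b : Fin s → ℝ} {φ : Fin s → ℝ → ℝ} {F : (Fin s → ℝ) → ℝ}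
  {L : Finset (Fin s) → ℝ} {C : Fin s → Matrix ℕ ℕ (ZMod 2)}

theorem abs_sum_sum_levelDiff_le (hab : ∀ i, a i ≤ b i)
    (hφ : ∀ i, IsInvertibleDensity (a i) (b i) (φ i)) (hF : HasMixedPartials a b F)
    (hL : ∀ u, ∀ x ∈ Set.Icc a b, |mixedPartial a b u F x| ≤ L u) (hL0 : ∀ u, 0 ≤ L u)
    {t m : ℕ} (q : ℕ) {ρ : Fin s → ℝ} (hρ : ∀ i, ρ i ∈ Set.Icc (0 : ℝ) (1 / 2 ^ m))
    {k : Fin s → ℕ} (hk : ∀ i, k i ≤ m) (hu : (levelSupport k).Nonempty)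
    (hC : t ≤ m → GeneratesDigitalNet t m fun i : levelSupport k => upperLeft m (C i)) :
    |∑ r ∈ Finset.range (2 ^ m), ∑ v ∈ Fintype.piFinset fun _ : Fin s => Finset.range (2 ^ m),
      levelDiff k (fun κ => F fun i =>
        gridNode a b φ m ρ i (mixDigits m (κ i) (cellIndex C m q r i) (v i)))| ≤
      (2 ^ m) ^ s * (2 ^ (levelSupport k).card *
        (2 ^ t * L (levelSupport k) * ∏ i ∈ levelSupport k, (b i - a i))) := by
  set V := Fintype.piFinset fun _ : Fin s => Finset.range (2 ^ m) with hV
  have hVcard : (V.card : ℝ) = (2 ^ m) ^ s := by simp [hV]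
  have hprod : 0 ≤ ∏ i ∈ levelSupport k, (b i - a i) :=
    Finset.prod_nonneg fun i _ => sub_nonneg.2 (hab i)
  rcases le_or_gt (t + ∑ i, k i) m with h | h
  · rw [sum_sum_levelDiff_eq_zero q hu (hC (by omega)) (by omega)
      (fun c => F fun i => gridNode a b φ m ρ i (c i)), abs_zero]
    have := hL0 (levelSupport k)
    positivity
  · rw [Finset.sum_comm]
    calc _ ≤ ∑ v ∈ V, ∑ r ∈ Finset.range (2 ^ m), |levelDiff k (fun κ => F fun i =>
          gridNode a b φ m ρ i (mixDigits m (κ i) (cellIndex C m q r i) (v i)))| :=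
          (Finset.abs_sum_le_sum_abs _ _).trans
            (Finset.sum_le_sum fun v _ => Finset.abs_sum_le_sum_abs _ _)
      _ ≤ ∑ v ∈ V, ∑ r ∈ Finset.range (2 ^ m), L (levelSupport k) * ∏ i ∈ levelSupport k,
          cellLength a b φ i (k i - 1) (cellIndex C m q r i / 2 ^ (m - (k i - 1))) :=
          Finset.sum_le_sum fun v _ => Finset.sum_le_sum fun r _ =>
            abs_levelDiff_le hab hφ hF hL hL0 hρ hk (cellIndex_lt C m q r)
      _ ≤ ∑ v ∈ V, L (levelSupport k) *
          (2 ^ (t + (levelSupport k).card) * ∏ i ∈ levelSupport k, (b i - a i)) := by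
          refine Finset.sum_le_sum fun v _ => ?_
          rw [← Finset.mul_sum]
          exact mul_le_mul_of_nonneg_left
            (sum_prod_cellLength_le hab hφ q hk hu hC h.le) (hL0 _)
      _ = _ := by
          rw [Finset.sum_const, nsmul_eq_mul, hVcard, pow_add]
          ring

/-- Vectors with support `u` have `m` choices in each direction of `u` and none elsewhere. -/
theorem sum_levelSupport {m : ℕ} (B : Finset (Fin s) → ℝ) :
    ∑ k ∈ Fintype.piFinset (fun _ : Fin s => Finset.range (m + 1)) with (levelSupport k).Nonempty,
      B (levelSupport k) = ∑ u : Finset (Fin s) with u.Nonempty, (m : ℝ) ^ u.card * B u := by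
  rw [← Finset.sum_fiberwise_of_maps_to (g := levelSupport)
    (t := Finset.univ.filter fun u : Finset (Fin s) => u.Nonempty)
    (fun k hk => by simpa using (Finset.mem_filter.1 hk).2)]
  refine Finset.sum_congr rfl fun u hu => ?_
  have hu' := (Finset.mem_filter.1 hu).2
  rw [Finset.sum_congr rfl fun k hk => by rw [(Finset.mem_filter.1 hk).2], Finset.sum_const,
    nsmul_eq_mul]
  congr 1
  have hset : Finset.filter (fun k => levelSupport k = u)
      (Finset.filter (fun k => (levelSupport k).Nonempty)
        (Fintype.piFinset fun _ : Fin s => Finset.range (m + 1))) =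
      Fintype.piFinset fun i => if i ∈ u then Finset.Icc 1 m else {0} := by
    ext k
    simp only [Finset.mem_filter, Fintype.mem_piFinset, Finset.mem_range]
    constructor
    · rintro ⟨⟨hk, -⟩, rfl⟩ i
      have := hk i
      by_cases hi : k i = 0
      · simp [mem_levelSupport, hi]
      · simp only [mem_levelSupport, ne_eq, hi, not_false_eq_true, if_true, Finset.mem_Icc]
        omega
    · intro h
      have h1 : levelSupport k = u := by
        ext i
        have := h i
        rw [mem_levelSupport]
        by_cases hi : i ∈ u
        · simp only [hi, if_true, Finset.mem_Icc] at this
          simp only [hi, iff_true]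
          omega
        · simpa [hi] using this
      refine ⟨⟨fun i => ?_, h1 ▸ hu'⟩, h1⟩
      have := h i
      by_cases hi : i ∈ u
      · simp only [hi, if_true, Finset.mem_Icc] at this
        omega
      · simp only [hi, if_false, Finset.mem_singleton] at this
        omega
  rw [hset, Fintype.card_piFinset]
  have : ∀ i : Fin s, (if i ∈ u then Finset.Icc 1 m else {0}).card = if i ∈ u then m else 1 := by
    intro i
    split_ifs <;> simp
  simp_rw [this]
  rw [Finset.prod_ite_mem, Finset.univ_inter, Finset.prod_const, Nat.cast_pow]

theorem abs_sum_cellIndex_sub_le (hab : ∀ i, a i ≤ b i)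
    (hφ : ∀ i, IsInvertibleDensity (a i) (b i) (φ i)) (hF : HasMixedPartials a b F)
    (hL : ∀ u, ∀ x ∈ Set.Icc a b, |mixedPartial a b u F x| ≤ L u) (hL0 : ∀ u, 0 ≤ L u)
    {t : Finset (Fin s) → ℕ} (hC : GeneratesDigitalSequenceFamily t C)
    (m q : ℕ) {ρ : Fin s → ℝ} (hρ : ∀ i, ρ i ∈ Set.Icc (0 : ℝ) (1 / 2 ^ m)) :
    |∑ r ∈ Finset.range (2 ^ m), F (fun i => gridNode a b φ m ρ i (cellIndex C m q r i)) -
      2 ^ m * ∑ v ∈ Fintype.piFinset fun _ : Fin s => Finset.range (2 ^ m),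
        (1 / ((2 ^ m : ℕ) : ℝ)) ^ s * F (fun i => gridNode a b φ m ρ i (v i))| ≤
      ∑ u : Finset (Fin s) with u.Nonempty,
        (2 * m : ℝ) ^ u.card * (2 ^ t u * L u * ∏ i ∈ u, (b i - a i)) := by
  set V := Fintype.piFinset fun _ : Fin s => Finset.range (2 ^ m) with hV
  set K := Fintype.piFinset fun _ : Fin s => Finset.range (m + 1) with hK
  have hVcard : (V.card : ℝ) = (2 ^ m) ^ s := by simp [hV]
  set D : (Fin s → ℕ) → ℕ → (Fin s → ℕ) → ℝ := fun k r v => levelDiff k (fun κ => F fun i =>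
        gridNode a b φ m ρ i (mixDigits m (κ i) (cellIndex C m q r i) (v i))) with hD
  -- Level `m` gives the block point and level `0` the grid point `v`; the term `k = 0` of the
  -- telescoping sum is moved to the left.
  have htel : ∀ r, ∀ v ∈ V, F (fun i => gridNode a b φ m ρ i (cellIndex C m q r i)) -
      F (fun i => gridNode a b φ m ρ i (v i)) =
      ∑ k ∈ K with (levelSupport k).Nonempty, D k r v := by
    intro r v hv
    have h := sum_levelDiff m (fun κ => F fun i =>
        gridNode a b φ m ρ i (mixDigits m (κ i) (cellIndex C m q r i) (v i)))
    rw [← Finset.sum_filter_add_sum_filter_not _ (fun k => (levelSupport k).Nonempty)] at h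
    simp only [mixDigits_self] at h
    rw [← h, add_sub_assoc, add_eq_left, sub_eq_zero]
    have hnot : K.filter (fun k => ¬ (levelSupport k).Nonempty) = {0} := by
      ext k
      simp only [Finset.mem_filter, Finset.not_nonempty_iff_eq_empty, Finset.mem_singleton]
      constructor
      · rintro ⟨-, h0⟩
        ext i
        by_contra hi
        exact Finset.notMem_empty i (h0 ▸ mem_levelSupport.2 hi)
      · rintro rfl
        exact ⟨by simp [hK], by ext; simp [mem_levelSupport]⟩
    have h0 : levelSupport (0 : Fin s → ℕ) = ∅ := by ext; simp [mem_levelSupport]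
    rw [hnot, Finset.sum_singleton, levelDiff, h0, Finset.powerset_empty, Finset.sum_singleton]
    simp only [Finset.card_empty, pow_zero, one_mul, Finset.piecewise_empty, Pi.zero_apply]
    refine congrArg F ?_
    ext i
    rw [mixDigits_zero (cellIndex_lt C m q r i)
      (Finset.mem_range.1 (Fintype.mem_piFinset.1 hv i))]
  have hpow : (0 : ℝ) < (2 ^ m) ^ s := by positivity
  have hmain : (2 ^ m : ℝ) ^ s *
      (∑ r ∈ Finset.range (2 ^ m), F (fun i => gridNode a b φ m ρ i (cellIndex C m q r i)) -
      2 ^ m * ∑ v ∈ V, (1 / ((2 ^ m : ℕ) : ℝ)) ^ s * F (fun i => gridNode a b φ m ρ i (v i))) =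
      ∑ k ∈ K with (levelSupport k).Nonempty, ∑ r ∈ Finset.range (2 ^ m), ∑ v ∈ V, D k r v := by
    have h1 : ∑ r ∈ Finset.range (2 ^ m), ∑ v ∈ V,
        (F (fun i => gridNode a b φ m ρ i (cellIndex C m q r i)) -
          F (fun i => gridNode a b φ m ρ i (v i))) =
        ∑ k ∈ K with (levelSupport k).Nonempty, ∑ r ∈ Finset.range (2 ^ m), ∑ v ∈ V, D k r v := by
      rw [Finset.sum_comm (s := K.filter _)]
      refine Finset.sum_congr rfl fun r _ => ?_
      rw [Finset.sum_comm (s := K.filter _)]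
      exact Finset.sum_congr rfl fun v hv => htel r v hv
    rw [← h1]
    simp_rw [Finset.sum_sub_distrib]
    rw [Finset.sum_const (s := Finset.range (2 ^ m)), Finset.card_range, nsmul_eq_mul,
      ← Finset.mul_sum]
    simp_rw [Finset.sum_const, nsmul_eq_mul, hVcard]
    rw [← Finset.mul_sum, mul_sub]
    have hone : (2 ^ m : ℝ) ^ s * (1 / 2 ^ m) ^ s = 1 := by
      rw [← mul_pow, mul_one_div_cancel (by positivity), one_pow]
    push_cast
    linear_combination
      (-(2 ^ m * ∑ v ∈ V, F fun i => gridNode a b φ m ρ i (v i))) * hone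
  refine le_of_mul_le_mul_left ?_ hpow
  rw [← abs_of_pos hpow, ← abs_mul, hmain, abs_of_pos hpow]
  refine (Finset.abs_sum_le_sum_abs _ _).trans ((Finset.sum_le_sum fun k hk => ?_).trans_eq
    ((sum_levelSupport fun u => (2 ^ m : ℝ) ^ s *
      (2 ^ u.card * (2 ^ t u * L u * ∏ i ∈ u, (b i - a i)))).trans ?_))
  · obtain ⟨hkK, hu⟩ := Finset.mem_filter.1 hk
    exact abs_sum_sum_levelDiff_le hab hφ hF hL hL0 q hρ
      (fun i => Nat.lt_succ_iff.1 (Finset.mem_range.1 (Fintype.mem_piFinset.1 hkK i))) hu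
      ((hC _ hu).2 m)
  · rw [Finset.mul_sum]
    refine Finset.sum_congr rfl fun u _ => ?_
    rw [mul_pow]
    ring

theorem abs_sum_block_le (hab : ∀ i, a i ≤ b i)
    (hφ : ∀ i, IsInvertibleDensity (a i) (b i) (φ i)) (hF : HasMixedPartials a b F)
    (hL : ∀ u, ∀ x ∈ Set.Icc a b, |mixedPartial a b u F x| ≤ L u) (hL0 : ∀ u, 0 ≤ L u)
    {t : Finset (Fin s) → ℕ} (hC : GeneratesDigitalSequenceFamily t C)
    (hCtri : ∀ i k l, l < k → C i k l = 0) (m q : ℕ) :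
    |∑ r ∈ Finset.range (2 ^ m),
        (F (fun i => invCdfOn (a i) (b i) (φ i) (digitalPoint C (2 ^ m * q + r) i)) -
          ∫ x in Set.Icc a b, F x * ∏ i, φ i (x i))| ≤
      ∑ u : Finset (Fin s) with u.Nonempty,
        ((2 * m : ℝ) ^ u.card + 1) * (2 ^ t u * L u * ∏ i ∈ u, (b i - a i)) := by
  have hρ := blockOffset_mem C m q
  have h1 := abs_sum_cellIndex_sub_le hab hφ hF hL hL0 hC m q hρ
  have h2 := abs_sum_sub_integral_le (M := 2 ^ m) (by positivity) hab hφ (hF.continuousOn hL)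
    (ℓ := fun i => L {i}) (fun i => hL0 _) (fun x hx y hy => hF.abs_sub_le hL hx hy)
    (z := gridNode a b φ m (blockOffset C m q)) (fun i c hc => by
      have := gridNode_mem hab hφ le_rfl hρ hc i
      rwa [Nat.sub_self, pow_zero, Nat.div_one] at this)
  have hpt : ∀ r ∈ Finset.range (2 ^ m),
      F (fun i => invCdfOn (a i) (b i) (φ i) (digitalPoint C (2 ^ m * q + r) i)) =
      F (fun i => gridNode a b φ m (blockOffset C m q) i (cellIndex C m q r i)) := by
    intro r hr
    refine congrArg F ?_
    ext i
    rw [digitalPoint_block hCtri q (Finset.mem_range.1 hr), gridNode]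
  -- The Riemann sum error is absorbed by the singletons among the nonempty `u`, using `1 ≤ 2 ^ t
  -- {i}`; it accounts for the `+ 1` in the bound.
  have h3 : ∑ i, L {i} * (b i - a i) ≤
      ∑ u : Finset (Fin s) with u.Nonempty, 2 ^ t u * L u * ∏ i ∈ u, (b i - a i) := by
    have hnn : ∀ u : Finset (Fin s), 0 ≤ 2 ^ t u * L u * ∏ i ∈ u, (b i - a i) := fun u =>
      mul_nonneg (mul_nonneg (by positivity) (hL0 u))
        (Finset.prod_nonneg fun i _ => sub_nonneg.2 (hab i))
    calc ∑ i, L {i} * (b i - a i) ≤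
          ∑ i, 2 ^ t {i} * L {i} * ∏ j ∈ {i}, (b j - a j) := by
          refine Finset.sum_le_sum fun i _ => ?_
          rw [Finset.prod_singleton, mul_assoc]
          exact le_mul_of_one_le_left (mul_nonneg (hL0 _) (sub_nonneg.2 (hab i)))
            (one_le_pow₀ one_le_two)
      _ = ∑ u ∈ Finset.univ.image fun i : Fin s => ({i} : Finset (Fin s)),
            2 ^ t u * L u * ∏ j ∈ u, (b j - a j) := by
          rw [Finset.sum_image]
          intro i _ j _ h
          exact Finset.singleton_injective h
      _ ≤ _ := by
          refine Finset.sum_le_sum_of_subset_of_nonneg ?_ fun u _ _ => hnn u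
          intro u hu
          obtain ⟨i, -, rfl⟩ := Finset.mem_image.1 hu
          simp
  rw [Finset.sum_sub_distrib, Finset.sum_congr rfl hpt, Finset.sum_const, Finset.card_range,
    nsmul_eq_mul]
  simp_rw [add_mul, one_mul]
  rw [Finset.sum_add_distrib]
  refine (abs_sub_le _ _ _).trans (add_le_add h1 (le_trans ?_ (h2.trans h3)))
  rw [Nat.cast_pow, Nat.cast_ofNat, ← mul_sub, abs_mul, abs_of_pos (by positivity)]

end Block

/-! ### Decomposition into blocks -/

/-- Binary splitting of `r`. The start `2 ^ M * q` is arbitrary because the remainder after a block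
of length `2 ^ M` starts at `2 ^ M * (2 * q + 1)`. -/
theorem abs_sum_range_le_of_blocks {f : ℕ → ℝ} {B : ℝ} (hB : 0 ≤ B) (M : ℕ)
    (h : ∀ m < M, ∀ q, |∑ r ∈ Finset.range (2 ^ m), f (2 ^ m * q + r)| ≤ B) :
    ∀ q r, r < 2 ^ M → |∑ n ∈ Finset.range r, f (2 ^ M * q + n)| ≤ M * B := by
  induction M with
  | zero =>
    intro q r hr
    have : r = 0 := by simpa using hr
    simp [this]
  | succ M ih =>
    intro q r hr
    have ih' := ih fun m hm => h m (hm.trans (Nat.lt_succ_self M))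
    rcases lt_or_ge r (2 ^ M) with hlt | hge
    · have := ih' (2 * q) r hlt
      rw [← mul_assoc, ← pow_succ] at this
      refine this.trans ?_
      gcongr
      exact Nat.le_succ M
    · obtain ⟨r', rfl⟩ := Nat.exists_eq_add_of_le hge
      have h1 := h M (Nat.lt_succ_self M) (2 * q)
      have h2 := ih' (2 * q + 1) r' (by rw [pow_succ] at hr; omega)
      rw [Finset.sum_range_add]
      have e1 : ∀ n, 2 ^ (M + 1) * q + n = 2 ^ M * (2 * q) + n := fun n => by ring
      simp only [e1]
      refine (abs_add_le _ _).trans ?_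
      have e3 : ∀ n, 2 ^ M * (2 * q) + (2 ^ M + n) = 2 ^ M * (2 * q + 1) + n := fun n => by ring
      simp only [e3]
      push_cast
      linarith

/-! ### Finite `ℓ^p` norms -/

section FinLpNorm

variable {ι : Type*} [Fintype ι]

theorem finLpNorm_top (f : ι → ℝ≥0∞) : finLpNorm ∞ f = ⨆ i, f i := if_pos rfl

theorem finLpNorm_of_ne_top {p : ℝ≥0∞} (hp : p ≠ ∞) (f : ι → ℝ≥0∞) :
    finLpNorm p f = (∑ i, f i ^ p.toReal) ^ (1 / p.toReal) := if_neg hp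

theorem finLpNorm_one (f : ι → ℝ≥0∞) : finLpNorm 1 f = ∑ i, f i := by
  simp [finLpNorm]

theorem le_finLpNorm {p : ℝ≥0∞} (hp : p ≠ 0) (f : ι → ℝ≥0∞) (i : ι) : f i ≤ finLpNorm p f := by
  by_cases htop : p = ∞
  · subst htop
    rw [finLpNorm_top]
    exact le_iSup f i
  · have hpos := ENNReal.toReal_pos hp htop
    rw [finLpNorm_of_ne_top htop, one_div, ENNReal.le_rpow_inv_iff hpos]
    exact Finset.single_le_sum (f := fun i => f i ^ p.toReal) (fun _ _ => zero_le) (Finset.mem_univ i)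

theorem finLpNorm_subtype_le (p : ℝ≥0∞) (f : ι → ℝ≥0∞) (P : ι → Prop) [DecidablePred P] :
    finLpNorm p (fun i : {i // P i} => f i) ≤ finLpNorm p f := by
  by_cases htop : p = ∞
  · subst htop
    rw [finLpNorm_top, finLpNorm_top]
    exact iSup_le fun i => le_iSup f i
  · rw [finLpNorm_of_ne_top htop, finLpNorm_of_ne_top htop]
    refine ENNReal.rpow_le_rpow ?_ (by positivity)
    rw [← Finset.sum_subtype (Finset.univ.filter P) (by simp) fun i => f i ^ p.toReal]
    exact Finset.sum_le_sum_of_subset (Finset.filter_subset _ _)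

theorem sum_mul_le_finLpNorm_mul {p q : ℝ≥0∞} (hpq : 1 / p + 1 / q = 1) (f g : ι → ℝ≥0∞) :
    ∑ i, f i * g i ≤ finLpNorm p f * finLpNorm q g := by
  rw [one_div, one_div] at hpq
  by_cases hp : p = ∞
  · subst hp
    have hq : q = 1 := by simpa using hpq
    subst hq
    rw [finLpNorm_top, finLpNorm_one, Finset.mul_sum]
    exact Finset.sum_le_sum fun i _ => mul_le_mul_left (le_iSup f i) _
  by_cases hq : q = ∞
  · subst hq
    have hp : p = 1 := by simpa using hpq
    subst hp
    rw [finLpNorm_top, finLpNorm_one, Finset.sum_mul]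
    exact Finset.sum_le_sum fun i _ => mul_le_mul_right (le_iSup g i) _
  have : ENNReal.HolderConjugate p q := ENNReal.holderConjugate_iff.2 hpq
  rw [finLpNorm_of_ne_top hp, finLpNorm_of_ne_top hq]
  exact ENNReal.inner_le_Lp_mul_Lq _ f g (ENNReal.HolderConjugate.toReal_of_ne_top hp hq)

end FinLpNorm

/-! ### The bound for the worst-case error -/

/-- From `m * log 2 ≤ log N` and `2 < 3 * log 2` follows `2 * m ≤ 3 * log N`, and `N ≥ 2` gives `1 ≤
3 * log N`. Both summands are thus at most `(3 * log N) ^ c`. -/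
theorem two_mul_pow_add_one_le {m N : ℕ} (hN : 2 ≤ N) (h : 2 ^ m ≤ N) (c : ℕ) :
    (2 * m : ℝ) ^ c + 1 ≤ 3 * (3 * Real.log N) ^ c := by
  have h2 := Real.log_two_gt_d9
  have hNr : (2 : ℝ) ≤ N := by exact_mod_cast hN
  have hlog : Real.log 2 ≤ Real.log N := Real.log_le_log two_pos hNr
  have hm : m * Real.log 2 ≤ Real.log N := by
    rw [← Real.log_pow]
    exact Real.log_le_log (by positivity) (by exact_mod_cast h)
  have h1 : (2 * m : ℝ) ^ c ≤ (3 * Real.log N) ^ c := by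
    refine pow_le_pow_left₀ (by positivity) ?_ c
    have : (m : ℝ) * 0.6931471803 ≤ m * Real.log 2 := by gcongr
    have : (0 : ℝ) ≤ m := Nat.cast_nonneg m
    linarith
  have h3 : 1 ≤ (3 * Real.log N) ^ c := one_le_pow₀ (by linarith)
  linarith

theorem size_le_log_div {N : ℕ} (hN : 1 ≤ N) : (N.size : ℝ) ≤ Real.log (2 * N) / Real.log 2 := by
  rw [le_div_iff₀ (Real.log_pos one_lt_two), ← Real.log_pow]
  refine Real.log_le_log (by positivity) ?_
  obtain ⟨k, hk⟩ := Nat.exists_eq_succ_of_ne_zero (Nat.size_pos.2 hN).ne'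
  have : 2 ^ k ≤ N := Nat.lt_size.1 (by omega)
  rw [hk, pow_succ']
  have h' : (2 : ℝ) ^ k ≤ N := by exact_mod_cast this
  linarith

theorem abs_qmcErr_le {s : ℕ} {a b : Fin s → ℝ} (hab : ∀ i, a i ≤ b i)
    {φ : Fin s → ℝ → ℝ} (hφ : ∀ i, IsInvertibleDensity (a i) (b i) (φ i))
    {F : (Fin s → ℝ) → ℝ} (hF : HasMixedPartials a b F) {L : Finset (Fin s) → ℝ}
    (hL : ∀ u, ∀ x ∈ Set.Icc a b, |mixedPartial a b u F x| ≤ L u) (hL0 : ∀ u, 0 ≤ L u)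
    {t : Finset (Fin s) → ℕ} {C : Fin s → Matrix ℕ ℕ (ZMod 2)}
    (hC : GeneratesDigitalSequenceFamily t C) (hCtri : ∀ i k l, l < k → C i k l = 0)
    {N : ℕ} (hN : 2 ≤ N) :
    |qmcErr a b φ (fun n : Fin N => digitalPoint C n) F| ≤
      1 / (N : ℝ) * (3 * Real.log (2 * N) / Real.log 2) *
        ∑ u : {u : Finset (Fin s) // u.Nonempty},
          L u * (2 ^ t u * (3 * Real.log N) ^ (u : Finset (Fin s)).card *
            ∏ i ∈ (u : Finset (Fin s)), (b i - a i)) := by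
  have hNr : (2 : ℝ) ≤ N := by exact_mod_cast hN
  have hlogN : 0 ≤ Real.log N := Real.log_nonneg (by linarith)
  set f : ℕ → ℝ := fun n => F (fun i => invCdfOn (a i) (b i) (φ i) (digitalPoint C n i)) -
    ∫ x in Set.Icc a b, F x * ∏ i, φ i (x i) with hf
  set T : Finset (Fin s) → ℝ := fun u =>
    L u * (2 ^ t u * (3 * Real.log N) ^ u.card * ∏ i ∈ u, (b i - a i)) with hT
  have hprod : ∀ u : Finset (Fin s), 0 ≤ ∏ i ∈ u, (b i - a i) := fun u =>
    Finset.prod_nonneg fun i _ => sub_nonneg.2 (hab i)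
  have hT0 : ∀ u, 0 ≤ T u := fun u => by
    have := hL0 u
    have := hprod u
    positivity
  have hsub : ∑ u : {u : Finset (Fin s) // u.Nonempty}, T u =
      ∑ u : Finset (Fin s) with u.Nonempty, T u :=
    (Finset.sum_subtype (Finset.univ.filter fun u : Finset (Fin s) => u.Nonempty) (by simp) T).symm
  have hsum0 : 0 ≤ ∑ u : Finset (Fin s) with u.Nonempty, T u := Finset.sum_nonneg fun u _ => hT0 u
  have hblock : ∀ m < N.size, ∀ q, |∑ r ∈ Finset.range (2 ^ m), f (2 ^ m * q + r)| ≤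
      3 * ∑ u : Finset (Fin s) with u.Nonempty, T u := by
    intro m hm q
    refine (abs_sum_block_le hab hφ hF hL hL0 hC hCtri m q).trans ?_
    rw [Finset.mul_sum]
    refine Finset.sum_le_sum fun u _ => ?_
    have hnn : 0 ≤ 2 ^ t u * L u * ∏ i ∈ u, (b i - a i) :=
      mul_nonneg (mul_nonneg (by positivity) (hL0 u)) (hprod u)
    refine (mul_le_mul_of_nonneg_right
      (two_mul_pow_add_one_le hN (Nat.lt_size.1 hm) u.card) hnn).trans_eq ?_
    simp only [hT]
    ring
  have hall := abs_sum_range_le_of_blocks (by positivity) N.size hblock 0 N (Nat.lt_size_self N)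
  simp only [mul_zero, zero_add] at hall
  have herr : qmcErr a b φ (fun n : Fin N => digitalPoint C n) F =
      1 / (N : ℝ) * ∑ n ∈ Finset.range N, f n := by
    rw [qmcErr, hf, Finset.sum_sub_distrib, Finset.sum_const, Finset.card_range, nsmul_eq_mul,
      mul_sub, ← mul_assoc, one_div_mul_cancel (by linarith), one_mul, ← Finset.sum_range
        fun n => F fun i => invCdfOn (a i) (b i) (φ i) (digitalPoint C n i)]
  rw [herr, abs_mul, abs_of_nonneg (by positivity), hsub, mul_assoc]
  refine mul_le_mul_of_nonneg_left (hall.trans ?_) (by positivity)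
  have := mul_le_mul_of_nonneg_right (size_le_log_div (N := N) (by omega)) hsum0
  calc _ = 3 * (N.size * ∑ u : Finset (Fin s) with u.Nonempty, T u) := by ring
    _ ≤ _ := mul_le_mul_of_nonneg_left this (by norm_num)
    _ = _ := by ring

theorem mainTheorem3 {s : ℕ} (hs : 1 ≤ s) (a b : Fin s → ℝ) (hab : ∀ i, a i < b i)
    (φ : Fin s → ℝ → ℝ) (hφ : ∀ i, IsInvertibleDensity (a i) (b i) (φ i))
    (γ : Finset (Fin s) → ℝ) (hγ : ∀ u, 0 < γ u)
    (p q : ℝ≥0∞) (hpq : 1 / p + 1 / q = 1)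
    (t : Finset (Fin s) → ℕ) (C : Fin s → Matrix ℕ ℕ (ZMod 2))
    (hC : GeneratesDigitalSequenceFamily t C)
    (hCtri : ∀ i, IsNonsingularUpperTriangular (C i))
    (N : ℕ) (hN : 2 ≤ N) :
    wce a b φ γ p (fun n : Fin N => digitalPoint C n) ≤
      ENNReal.ofReal (1 / (N : ℝ) * (3 * Real.log (2 * N) / Real.log 2)) *
        finLpNorm q (fun u : {u : Finset (Fin s) // u.Nonempty} =>
          ENNReal.ofReal (γ u * 2 ^ t u * (3 * Real.log N) ^ (u : Finset (Fin s)).card *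
            ∏ i ∈ (u : Finset (Fin s)), (b i - a i))) := by
  refine iSup_le fun F => iSup_le fun hF => iSup_le fun hnorm => ?_
  have hp0 : p ≠ 0 := by
    rintro rfl
    simp at hpq
  have hNr : (2 : ℝ) ≤ N := by exact_mod_cast hN
  have hlogN : 0 ≤ Real.log N := Real.log_nonneg (by linarith)
  have hlog2N : 0 ≤ Real.log (2 * N) := Real.log_nonneg (by linarith)
  have hlog2 : 0 < Real.log 2 := Real.log_pos one_lt_two
  set S : Finset (Fin s) → ℝ≥0∞ := fun u =>
    ⨆ x ∈ Set.Icc a b, ENNReal.ofReal |mixedPartial a b u F x| with hS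
  -- Finiteness makes `(S u).toReal` a genuine bound; at `∞` it would be the default value `0`.
  have hfin : ∀ u, S u ≠ ∞ := by
    intro u htop
    have h := (le_finLpNorm hp0 (fun u => ENNReal.ofReal (1 / γ u) * S u) u).trans hnorm
    rw [htop, ENNReal.mul_top (by simpa using hγ u)] at h
    exact absurd h (by simp)
  have hL : ∀ u, ∀ x ∈ Set.Icc a b, |mixedPartial a b u F x| ≤ (S u).toReal := by
    intro u x hx
    rw [← ENNReal.ofReal_le_iff_le_toReal (hfin u)]
    exact le_iSup₂ (f := fun x (_ : x ∈ Set.Icc a b) =>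
      ENNReal.ofReal |mixedPartial a b u F x|) x hx
  have herr := abs_qmcErr_le (fun i => (hab i).le) hφ hF hL (fun u => ENNReal.toReal_nonneg) hC
    (fun i => (hCtri i).1) hN
  refine (ENNReal.ofReal_le_ofReal herr).trans ?_
  rw [ENNReal.ofReal_mul (by positivity)]
  refine mul_le_mul_right ?_ _
  have hterm : ∀ u : Finset (Fin s), 0 ≤ 2 ^ t u * (3 * Real.log N) ^ u.card *
      ∏ i ∈ u, (b i - a i) := fun u =>
    mul_nonneg (by positivity) (Finset.prod_nonneg fun i _ => sub_nonneg.2 (hab i).le)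
  rw [ENNReal.ofReal_sum_of_nonneg fun (u : {u : Finset (Fin s) // u.Nonempty}) _ =>
    mul_nonneg ENNReal.toReal_nonneg (hterm u)]
  -- Each term is written as `(γ u)⁻¹ * S u` times `γ u` times the rest. After Hölder, the first
  -- factor is the norm of `F` restricted to nonempty `u`, hence at most `1`.
  refine le_trans (Finset.sum_le_sum fun u _ => ?_) ((sum_mul_le_finLpNorm_mul hpq
    (fun u : {u : Finset (Fin s) // u.Nonempty} => ENNReal.ofReal (1 / γ u) * S u) _).trans
    (mul_le_of_le_one_left zero_le
      ((finLpNorm_subtype_le p (fun u => ENNReal.ofReal (1 / γ u) * S u) _).trans hnorm)))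
  refine le_of_eq ?_
  rw [mul_right_comm (ENNReal.ofReal _), ← ENNReal.ofReal_mul (by have := hγ u; positivity),
    ENNReal.ofReal_mul ENNReal.toReal_nonneg, ENNReal.ofReal_toReal (hfin u), mul_comm]
  congr 2
  have := (hγ u).ne'
  field_simp
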